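/- **Setting.** Let $\Xi$ be a Polish space, $P$ a Markov kernel on $\Xi$, $H:\mathbb R^d\times\Xi\to\mathbb R^d$ measurable, $\|\cdot\|$ a norm on $\mathbb R^d$, and write $\mathcal P h(\xi)=\int h(\xi')P(\xi,d\xi')$. Let $(\xi_t)_{t\ge0}$ be a Markov chain with kernel $P$ and arbitrary initial law, $\pi$ its stationary distribution, $g(x)=\int H(x,\xi)\,\pi(d\xi)$, $g(x^\star)=0$, and let $x_{t+1}=x_t-\eta_tH(x_t,\xi_t)$ with deterministic $x_0$. Assume: 1. there are a matrix $G$ with $-G$ Hurwitz (all eigenvalues of $-G$ have negative real part) and $L_G,\delta_G>0$ with $\|g(x)-G(x-x^\star)\|\le L_G\|x-x^\star\|^2$ whenever $\|x-x^\star\|\le\delta_G$; 2. for some $p>2$, $\sup_t \mathbb E\|H(x^\star,\xi_t)\|^p<\infty$, and $\mathcal P H(x^\star,\cdot)$ is well defined (absolutely convergent integrals) and bounded on $\Xi$; 3. for some $L_H$, $\left(\int\|H(x,\xi')-H(y,\xi')\|^pP(\xi,d\xi')\right)^{1/p}\le L_H\|x-y\|$ for all $x,y,\xi$; 4. $\pi$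 is the unique stationary distribution, and $d_{\rm TV}(P^t(\xi,\cdot),\pi)\le\kappa\rho^t/2$ for all $\xi,t$, with some $\kappa\ge e$, $\rho\in[0,1)$ (here $d_{\rm TV}(\mu,\nu)=\sup_A|\mu(A)-\nu(A)|$); 5. $0<\eta_t\le1$, $\eta_t\downarrow0$, $\eta_t\log^2t\to0$, $t\eta_t\uparrow\infty$, $(\eta_{t-1}-\eta_t)/\eta_{t-1}=o(\eta_{t-1})$, $\sum_{t\ge1} t^{-1/2}\eta_t\log t<\infty$, and $\sum_{t=0}^T\eta_t\le C\,T\eta_T$ for all $T\ge1$; 6. $\left(\mathbb E\|x_t-x^\star\|^2\right)^{1/2}\le C'(1+\log t)\sqrt{\eta_t}$ for all $t\ge 0$ (reading $\log 0=0$) and $\sup_t\mathbb E\|x_t-x^\star\|^p<\infty$. Let $U(x,\xi)=\sum_{t\ge0}\left(\mathcal P^tH(x,\cdot)(\xi)-g(x)\right)$, the $\pi$-mean-zero solution of the Poisson equation $U-\mathcal PU=H-g$; let $S=\mathbb E_{\xi\sim\pi}\left[U(x^\star,\xi)U(x^\star,\xi)^\top-\mathcal PU(x^\star,\xi)\,\mathcal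 PU(x^\star,\xi)^\top\right]$ and $\psi=G^{-1}S^{1/2}B$ with $B$ a standard $d$-dimensional Brownian motion on $[0,1]$. For $T\ge1$ let $\phi^c_T:[0,1]\to\mathbb R^d$ be the continuous function that is linear on each $[n/T,(n+1)/T]$, $0\le n<T$, with $\phi^c_T(n/T)=T^{-1/2}\sum_{t=0}^{n}(x_t-x^\star)$ for $0\le n\le T$. For an integer $m\ge1$ and $\phi\in C([0,1],\mathbb R)$ put $$h_m(\phi)=\Big(\int_0^1|\phi(r)-r\phi(1)|^m\,dr\Big)^{1/m},\qquad f_m(\phi)=\frac{\phi(1)}{h_m(\phi)}$$ (with $f_m(\phi)=0$ if $h_m(\phi)=0$). Let $W$ be a standard one-dimensional Brownian motion on $[0,1]$. For $\theta\in\mathbb R^d$ let $\omega=\|\theta^\top G^{-1}S^{1/2}\|_2$, let $\varepsilon_{\rm P}=d_{\rm P}(\theta^\top\phi^c_T,\theta^\top\psi)$ be the Lévy–Prokhorov distance between the laws on $C([0,1],\mathbb R)$ with the uniform metric, and let $$e(m,x)=\big|\mathbb P(|f_m(\theta^\top\phi^c_T)|>x)-\mathbb P(|f_m(W)|>x)\big|.$$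 **Theorem.** For every integer $m\ge1$ the random variable $f_m(W)$ has a continuous probability density $r(f_m(W),\cdot)$. Assume moreover that $\omega>0$. Then for all $x>0$, $z>0$ and all $T\ge1$, $$e(m,x)\le 2\left[r(f_m(W),x)\,\frac{x+1}{z}\cdot\frac{\varepsilon_{\rm P}}{\omega}+\max\big\{\mathbb P(|f_m(W)|>x,\ h_m(W)\le z),\ \mathbb P(|f_m(W)|\le x,\ h_m(W)\le z)\big\}\right]+R(\varepsilon_{\rm P}),$$ where $R:\mathbb R\to\mathbb R$ satisfies $R(\varepsilon)=o(\varepsilon)$ as $\varepsilon\to0$ and depends only on $m$, $x$, $z$ and $\omega$. -/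

import Mathlib

open MeasureTheory ProbabilityTheory Filter Topology Asymptotics
open scoped ENNReal NNReal unitInterval

noncomputable section

/-! ### Path space and the functionals `h_m`, `f_m` -/

/-- `ℝ^d` as column vectors; its built-in norm is the Euclidean norm. -/
abbrev Vec (d : ℕ) := EuclideanSpace ℝ (Fin d)

/-- The Borel `σ`-algebra of the uniform topology on `C([0,1], ℝ)`. -/
instance pathMeasurableSpace : MeasurableSpace C(I, ℝ) := borel _

instance pathBorelSpace : BorelSpace C(I, ℝ) := ⟨rfl⟩

/-- `h_m(φ) = (∫₀¹ |φ(r) - r φ(1)|^m dr)^{1/m}`. -/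
def hFun (m : ℕ) (φ : C(I, ℝ)) : ℝ :=
  (∫ r : I, |φ r - (r : ℝ) * φ 1| ^ m) ^ (1 / (m : ℝ))

/-- `f_m(φ) = φ(1) / h_m(φ)` (with value `0` where the denominator vanishes). -/
def fFun (m : ℕ) (φ : C(I, ℝ)) : ℝ := φ 1 / hFun m φ

/-- The scalar path `r ↦ θᵀ φ(r)`. -/
def projPath {d : ℕ} (θ : Vec d) (φ : C(I, Vec d)) : C(I, ℝ) :=
  ⟨fun r => inner ℝ θ (φ r), by fun_prop⟩

/-- The path `r ↦ A φ(r)`. -/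
def matPath {d : ℕ} (A : Matrix (Fin d) (Fin d) ℝ) (φ : C(I, Vec d)) : C(I, Vec d) :=
  ⟨fun r => Matrix.toEuclideanCLM (𝕜 := ℝ) A (φ r), by fun_prop⟩

/-- The `i`-th coordinate path. -/
def coordPath {d : ℕ} (i : Fin d) (φ : C(I, Vec d)) : C(I, ℝ) :=
  ⟨fun r => φ r i, by fun_prop⟩

/-! ### Brownian motion on `[0,1]` -/

/-- `W` is a standard one-dimensional Brownian motion on `[0,1]` (all paths continuous). -/
structure IsBrownianMotion {Ω : Type*} [MeasurableSpace Ω] (W : Ω → C(I, ℝ))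
    (Pr : Measure Ω) : Prop where
  measurable_eval : ∀ t : I, Measurable fun ω => W ω t
  zero : ∀ᵐ ω ∂Pr, W ω 0 = 0
  indep : HasIndepIncrements (fun (t : I) ω => W ω t) Pr
  gaussian : ∀ s t : I, s ≤ t →
    HasLaw (fun ω => W ω t - W ω s) (gaussianReal 0 (Real.toNNReal ((t : ℝ) - s))) Pr

/-- `W` is a standard `d`-dimensional Brownian motion on `[0,1]`: its coordinates are independent
standard one-dimensional Brownian motions. -/
structure IsBrownianMotionVec {d : ℕ} {Ω : Type*} [MeasurableSpace Ω] (W : Ω → C(I, Vec d))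
    (Pr : Measure Ω) : Prop where
  coord : ∀ i, IsBrownianMotion (fun ω => coordPath i (W ω)) Pr
  indep : iIndepFun (fun (i : Fin d) ω (t : I) => W ω t i) Pr

/-! ### Stochastic approximation with Markovian data -/

/-- The data of a stochastic approximation problem on `ℝ^d`. -/
structure SAProblem (d : ℕ) (Ξ : Type*) [MeasurableSpace Ξ] where
  /-- the (arbitrary) norm `‖·‖` on `ℝ^d` -/
  nrm : Seminorm ℝ (Vec d)
  nrm_definite : ∀ v, nrm v = 0 → v = 0
  /-- the noisy operator `H(x, ξ)` -/
  H : Vec d → Ξ → Vec d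
  measurable_H : Measurable fun q : Vec d × Ξ => H q.1 q.2
  /-- the transition kernel of the data chain -/
  P : Kernel Ξ Ξ
  markov_P : IsMarkovKernel P
  /-- the stationary distribution -/
  π : Measure Ξ
  prob_π : IsProbabilityMeasure π
  /-- the root `x⋆` -/
  xstar : Vec d
  /-- the initial iterate -/
  x0 : Vec d
  /-- the step sizes -/
  η : ℕ → ℝ
  /-- the local linearity matrix -/
  G : Matrix (Fin d) (Fin d) ℝ
  /-- the moment exponent -/
  p : ℝ

/-- `d_TV(μ, ν) = sup_A |μ(A) - ν(A)|`. -/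
def tvDist {Ξ : Type*} [MeasurableSpace Ξ] (μ ν : Measure Ξ) : ℝ :=
  sSup ((fun A => |μ.real A - ν.real A|) '' {A | MeasurableSet A})

/-- `ξ` is a time-homogeneous Markov chain with transition kernel `P` (and any initial law): the
conditional distribution of `ξ_{t+1}` given `(ξ_0, …, ξ_t)` is `P(ξ_t, ·)`. -/
def IsMarkovChain {Ω Ξ : Type*} [MeasurableSpace Ω] [MeasurableSpace Ξ]
    (P : Kernel Ξ Ξ) (ξ : ℕ → Ω → Ξ) (Pr : Measure Ω) : Prop :=
  (∀ t, Measurable (ξ t)) ∧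
  ∀ t : ℕ, HasCondDistrib (ξ (t + 1)) (fun ω (i : Finset.Iic t) => ξ i ω)
    (P.comap (fun h : Finset.Iic t → Ξ => h ⟨t, by simp⟩) (measurable_pi_apply _)) Pr

/-- A real matrix is Hurwitz if all its complex eigenvalues have negative real part. -/
def IsHurwitz {d : ℕ} (A : Matrix (Fin d) (Fin d) ℝ) : Prop :=
  ∀ μ ∈ spectrum ℂ (A.map (algebraMap ℝ ℂ)), μ.re < 0

namespace SAProblem

variable {d : ℕ} {Ξ : Type*} [MeasurableSpace Ξ] (M : SAProblem d Ξ)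

/-- `g(x) = ∫ H(x, ξ) π(dξ)`. -/
def g (x : Vec d) : Vec d := ∫ s, M.H x s ∂M.π

/-- `(𝒫 h)(ξ) = ∫ h(ξ') P(ξ, dξ')`. -/
def markovOp (h : Ξ → Vec d) (s : Ξ) : Vec d := ∫ s', h s' ∂(M.P s)

/-- The solution `U(x, ξ) = ∑_{t ≥ 0} (𝒫ᵗ H(x, ·)(ξ) - g(x))` of the Poisson equation
`U - 𝒫 U = H - g`, normalised by `∫ U(x, ξ) π(dξ) = 0`. -/
def U (x : Vec d) (s : Ξ) : Vec d := ∑' t : ℕ, (M.markovOp^[t] (M.H x) s - M.g x)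

/-- `S = E_π[U(x⋆,ξ) U(x⋆,ξ)ᵀ - 𝒫U(x⋆,ξ) 𝒫U(x⋆,ξ)ᵀ]`. -/
def S : Matrix (Fin d) (Fin d) ℝ := Matrix.of fun i j =>
  ∫ s, (M.U M.xstar s i * M.U M.xstar s j -
    M.markovOp (M.U M.xstar) s i * M.markovOp (M.U M.xstar) s j) ∂M.π

section
open scoped MatrixOrder

/-- The matrix `G⁻¹ S^{1/2}`, with the positive semidefinite square root. -/
def scaleMatrix : Matrix (Fin d) (Fin d) ℝ := M.G⁻¹ * CFC.sqrt M.S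

end

/-- `ω = ‖θᵀ G⁻¹ S^{1/2}‖₂`. -/
def scale (θ : Vec d) : ℝ := ‖WithLp.toLp 2 (Matrix.vecMul θ.ofLp M.scaleMatrix)‖

variable {Ω : Type*}

/-- The iterates `x_{t+1} = x_t - η_t H(x_t, ξ_t)`. -/
def iter (ξ : ℕ → Ω → Ξ) : ℕ → Ω → Vec d
  | 0, _ => M.x0
  | t + 1, ω => iter ξ t ω - M.η t • M.H (iter ξ t ω) (ξ t ω)

/-- The càdlàg partial-sum process `φ_T(r) = T^{-1/2} ∑_{t=0}^{⌊Tr⌋} (x_t - x⋆)`. -/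
def partialSum (ξ : ℕ → Ω → Ξ) (T : ℕ) (ω : Ω) (r : ℝ) : Vec d :=
  (Real.sqrt T)⁻¹ • ∑ t ∈ Finset.range (⌊(T : ℝ) * r⌋₊ + 1), (M.iter ξ t ω - M.xstar)

/-- The continuous process `φᶜ_T`, the linear interpolation of the points `(n/T, φ_T(n/T))`,
`0 ≤ n ≤ T`, written as the sum of its linear pieces; see `interp_eq`. -/
def interp (ξ : ℕ → Ω → Ξ) (T : ℕ) (ω : Ω) : C(I, Vec d) where
  toFun r := M.partialSum ξ T ω 0 + ∑ n ∈ Finset.range T,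
    max 0 (min 1 ((T : ℝ) * r - n)) •
      (M.partialSum ξ T ω ((n + 1 : ℝ) / T) - M.partialSum ξ T ω ((n : ℝ) / T))
  continuous_toFun := by fun_prop

/-- On `[n/T, (n+1)/T]` the process `φᶜ_T` is
`φ_T(n/T) + (T r - n) (φ_T((n+1)/T) - φ_T(n/T))`. -/
theorem interp_eq (ξ : ℕ → Ω → Ξ) (T : ℕ) (ω : Ω) (n : ℕ) (hn : n < T) (r : I)
    (h1 : (n : ℝ) / T ≤ r) (h2 : (r : ℝ) ≤ (n + 1 : ℝ) / T) :
    M.interp ξ T ω r = M.partialSum ξ T ω ((n : ℝ) / T) + ((T : ℝ) * r - n) •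
      (M.partialSum ξ T ω ((n + 1 : ℝ) / T) - M.partialSum ξ T ω ((n : ℝ) / T)) := by
  have hT : (0 : ℝ) < T := by exact_mod_cast (Nat.zero_le n).trans_lt hn
  rw [div_le_iff₀ hT] at h1
  rw [le_div_iff₀ hT] at h2
  have hsplit : Finset.range T = Finset.range (n + 1) ∪ Finset.Ico (n + 1) T := by
    ext k; simp only [Finset.mem_union, Finset.mem_range, Finset.mem_Ico]; omega
  have hdisj : Disjoint (Finset.range (n + 1)) (Finset.Ico (n + 1) T) := by
    rw [Finset.disjoint_left]; intro k; simp only [Finset.mem_range, Finset.mem_Ico]; omega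
  have hhigh : ∑ k ∈ Finset.Ico (n + 1) T, max 0 (min 1 ((T : ℝ) * r - k)) •
      (M.partialSum ξ T ω ((k + 1 : ℝ) / T) - M.partialSum ξ T ω ((k : ℝ) / T)) = 0 := by
    refine Finset.sum_eq_zero fun k hk => ?_
    have hk' : (n : ℝ) + 1 ≤ k := by exact_mod_cast (Finset.mem_Ico.1 hk).1
    rw [max_eq_left ((min_le_right _ _).trans (by linarith)), zero_smul]
  have hlow : ∑ k ∈ Finset.range n, max 0 (min 1 ((T : ℝ) * r - k)) •
      (M.partialSum ξ T ω ((k + 1 : ℝ) / T) - M.partialSum ξ T ω ((k : ℝ) / T)) =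
      M.partialSum ξ T ω ((n : ℝ) / T) - M.partialSum ξ T ω 0 := by
    have := Finset.sum_range_sub (fun k : ℕ => M.partialSum ξ T ω ((k : ℝ) / T)) n
    simp only [Nat.cast_add, Nat.cast_one, Nat.cast_zero, zero_div] at this
    rw [← this]
    refine Finset.sum_congr rfl fun k hk => ?_
    have hk' : (k : ℝ) + 1 ≤ n := by exact_mod_cast Finset.mem_range.1 hk
    rw [min_eq_left (by linarith), max_eq_right zero_le_one, one_smul]
  have hmid : max 0 (min 1 ((T : ℝ) * r - n)) = (T : ℝ) * r - n := by
    rw [min_eq_right (by linarith), max_eq_right (by linarith)]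
  change M.partialSum ξ T ω 0 + ∑ k ∈ Finset.range T, _ = _
  rw [hsplit, Finset.sum_union hdisj, hhigh, Finset.sum_range_succ, hlow, hmid]
  abel

/-- The `L^q` size `(E ‖f‖^q)^{1/q}`, an extended non-negative real. -/
def lpSize {α : Type*} [MeasurableSpace α] (q : ℝ) (f : α → Vec d) (μ : Measure α) : ℝ≥0∞ :=
  (∫⁻ a, ENNReal.ofReal (M.nrm (f a)) ^ q ∂μ) ^ (1 / q)

/-- Local linearity at the root. -/
def LocalLinearity : Prop :=
  IsHurwitz (-M.G) ∧ ∃ L δ : ℝ, 0 < L ∧ 0 < δ ∧ ∀ x, M.nrm (x - M.xstar) ≤ δ →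
    M.nrm (M.g x - WithLp.toLp 2 (M.G.mulVec (x - M.xstar).ofLp)) ≤
      L * M.nrm (x - M.xstar) ^ 2

/-- Moment bounds for the noise at the root. -/
def RegularNoise [MeasurableSpace Ω] (ξ : ℕ → Ω → Ξ) (Pr : Measure Ω) : Prop :=
  (⨆ t, M.lpSize M.p (fun ω => M.H M.xstar (ξ t ω)) Pr) < ∞ ∧
  (∀ s, Integrable (M.H M.xstar) (M.P s)) ∧
  ∃ C : ℝ, 0 < C ∧ ∀ s, M.nrm (M.markovOp (M.H M.xstar) s) ≤ C

/-- Uniform averaged Lipschitz continuity of `H(·, ξ)`. -/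
def AveragedLipschitz : Prop :=
  ∃ L : ℝ, 0 ≤ L ∧ ∀ x y s,
    M.lpSize M.p (fun s' => M.H x s' - M.H y s') (M.P s) ≤ ENNReal.ofReal (L * M.nrm (x - y))

/-- The data form a uniformly (geometrically) ergodic Markov chain whose unique stationary
distribution is `π`. -/
def UniformlyErgodic [MeasurableSpace Ω] (ξ : ℕ → Ω → Ξ) (Pr : Measure Ω) : Prop :=
  IsMarkovChain M.P ξ Pr ∧
  M.P.Invariant M.π ∧
  (∀ π' : Measure Ξ, IsProbabilityMeasure π' → M.P.Invariant π' → π' = M.π) ∧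
  ∃ κ ρ : ℝ, Real.exp 1 ≤ κ ∧ 0 ≤ ρ ∧ ρ < 1 ∧
    ∀ s (t : ℕ), tvDist ((M.P ^ t) s) M.π ≤ κ * ρ ^ t / 2

/-- Slowly decaying step sizes. -/
structure SlowSteps : Prop where
  pos : ∀ t, 0 < M.η t
  le_one : ∀ t, M.η t ≤ 1
  antitone : Antitone M.η
  tendsto_zero : Tendsto M.η atTop (𝓝 0)
  log_sq : Tendsto (fun t : ℕ => M.η t * Real.log t ^ 2) atTop (𝓝 0)
  mul_monotone : Monotone fun t : ℕ => (t : ℝ) * M.η t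
  mul_tendsto : Tendsto (fun t : ℕ => (t : ℝ) * M.η t) atTop atTop
  ratio : (fun t : ℕ => (M.η t - M.η (t + 1)) / M.η t) =o[atTop] M.η
  summable : Summable fun t : ℕ => Real.log t / Real.sqrt t * M.η t
  average : ∃ C : ℝ, ∀ T : ℕ, 1 ≤ T →
    (∑ t ∈ Finset.range (T + 1), M.η t) / (T * M.η T) ≤ C

/-- `(L², (1 + log t) √η_t)`-consistency and bounded `p`-th moments of the iterates. -/
def Consistent [MeasurableSpace Ω] (ξ : ℕ → Ω → Ξ) (Pr : Measure Ω) : Prop :=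
  (∃ C : ℝ, 1 ≤ C ∧ ∀ t : ℕ, M.lpSize 2 (fun ω => M.iter ξ t ω - M.xstar) Pr ≤
    ENNReal.ofReal (C * ((1 + Real.log t) * Real.sqrt (M.η t)))) ∧
  (⨆ t, ∫⁻ ω, ENNReal.ofReal (M.nrm (M.iter ξ t ω - M.xstar)) ^ M.p ∂Pr) < ∞

/-- The standing assumptions on the stochastic approximation scheme driven by the data `ξ`. -/
structure Assumptions [MeasurableSpace Ω] (ξ : ℕ → Ω → Ξ) (Pr : Measure Ω) : Prop where
  root : M.g M.xstar = 0
  two_lt_p : 2 < M.p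
  localLinearity : M.LocalLinearity
  regularNoise : M.RegularNoise ξ Pr
  lipschitz : M.AveragedLipschitz
  ergodic : M.UniformlyErgodic ξ Pr
  steps : M.SlowSteps
  consistent : M.Consistent ξ Pr

/-- `ε_P`, the Lévy–Prokhorov distance on `C([0,1], ℝ)` (uniform metric) between the laws of
`θᵀ φᶜ_T` and of `θᵀ ψ`, where `ψ = G⁻¹ S^{1/2} B`. -/
def epsP [MeasurableSpace Ω] (ξ : ℕ → Ω → Ξ) (Pr : Measure Ω) {Ω' : Type*} [MeasurableSpace Ω']
    (B : Ω' → C(I, Vec d)) (Pr' : Measure Ω') (θ : Vec d) (T : ℕ) : ℝ :=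
  levyProkhorovDist (Pr.map fun ω => projPath θ (M.interp ξ T ω))
    (Pr'.map fun ω => projPath θ (matPath M.scaleMatrix (B ω)))

/-- `e(m, x) = |Pr(|f_m(θᵀ φᶜ_T)| > x) - Pr(|f_m(W)| > x)|`. -/
def rejectionError [MeasurableSpace Ω] (ξ : ℕ → Ω → Ξ) (Pr : Measure Ω) {Ω₀ : Type*}
    [MeasurableSpace Ω₀] (W : Ω₀ → C(I, ℝ)) (Pr₀ : Measure Ω₀) (θ : Vec d) (T m : ℕ) (x : ℝ) : ℝ :=
  |Pr.real {ω | x < |fFun m (projPath θ (M.interp ξ T ω))|} - Pr₀.real {ω | x < |fFun m (W ω)|}|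

end SAProblem

end

/-! ### The Borel structure of the path space -/

section PathSpace

/-! The process `θᵀψ` is a continuous centred Gaussian process whose covariance is `ω²` times that
of `W`, so it has the law of `ωW` on path space (`IsBrownianMotionVec.map_projPath_matPath`). Since
`f_m` is invariant under positive scaling, the error compares `|f_m|` under two laws on `C([0,1],
ℝ)` at distance `ε_P`.

Density: `h_m(W)` depends only on the bridge `W(r) - r W(1)`, which is uncorrelated with, hence
independent of, the Gaussian variable `W(1)`. Thus `f_m(W)` is a standard Gaussian divided by an
independent, almost surely positive `H = h_m(W)`, and has density `r(y) = E[H φ(H y)]` with `φ` the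
Gaussian density. Integrability of `H` makes `r` continuous by dominated convergence
(`map_div_eq_withDensity`, `continuous_gaussianRatioDensity`).

Comparison: a uniform perturbation of size `δ` moves `φ(1)` by at most `δ` and `h_m` by at most
`2δ`. Off the event `h_m(W) ≤ z`, it therefore moves `|f_m|` across `x` only if `|f_m(W)|` lies
within `(1 + 2x) δ / (ω z)` of `x`. This bounds the error by a band probability, one copy of the
small-denominator probability and a multiple of `ε_P` (`abs_sub_le_rejectionBound`).

Remainder: that bound is continuous in `ε` and at `ε = 0` equals a single copy of the
small-denominator probability, while the claimed bound contains two. This probability is positive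
because Brownian motion stays near zero with positive probability (`measure_norm_lt_pos`). The spare
copy absorbs every `ε`-dependent term for small `ε`, whatever the linear coefficients, so the
remainder can be taken to vanish identically near `0`. -/

/-- Evaluation of a path along a dense sequence of times. -/
noncomputable def evalDense (φ : C(I, ℝ)) (n : ℕ) : ℝ := φ (TopologicalSpace.denseSeq I n)

/-- A continuous injection between Polish spaces is a Borel embedding (Lusin–Souslin). Hence
countably many evaluations generate the Borel structure of path space, and laws on it can be
compared on `ℝ^ℕ`. -/
theorem measurableEmbedding_evalDense : MeasurableEmbedding evalDense := by
  refine Continuous.measurableEmbedding (by unfold evalDense; fun_prop) fun φ ψ h => ?_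
  refine DFunLike.coe_injective
    (Continuous.ext_on (TopologicalSpace.denseRange_denseSeq I) φ.continuous ψ.continuous ?_)
  rintro _ ⟨n, rfl⟩
  exact congrFun h n

theorem measurable_path {Ω : Type*} [MeasurableSpace Ω] {W : Ω → C(I, ℝ)}
    (hW : ∀ t, Measurable fun ω => W ω t) : Measurable W :=
  measurableEmbedding_evalDense.measurable_comp_iff.1 <|
    measurable_pi_lambda _ fun _ => hW _

/-- The random path generates the same `σ`-algebra as its values along the dense sequence, so
independence of the family of evaluations passes to the path. -/
theorem ProbabilityTheory.IndepFun.path_of_eval {Ω β : Type*} [MeasurableSpace Ω]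
    [MeasurableSpace β] {Pr : Measure Ω} {X : Ω → β} {W : Ω → C(I, ℝ)}
    (h : IndepFun X (fun ω (t : I) => W ω t) Pr) : IndepFun X W Pr := by
  have h' : IndepFun X (fun ω => evalDense (W ω)) Pr :=
    h.comp measurable_id (φ := id)
      (ψ := fun (u : I → ℝ) n => u (TopologicalSpace.denseSeq I n)) (by fun_prop)
  rw [IndepFun_iff_Indep] at h' ⊢
  convert h' using 1
  rw [← measurableEmbedding_evalDense.comap_eq, MeasurableSpace.comap_comp]
  rfl

end PathSpace

/-! ### Laws of Gaussian processes -/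

section GaussianLaw

/-- The finite-dimensional laws of a real Gaussian process are determined by its mean and
covariance functions. -/
theorem ProbabilityTheory.IsGaussianProcess.map_restrict_eq {T Ω Ω' : Type*} [MeasurableSpace Ω]
    [MeasurableSpace Ω'] {P : Measure Ω} {P' : Measure Ω'} {X : T → Ω → ℝ} {Y : T → Ω' → ℝ}
    (hX : IsGaussianProcess X P) (hY : IsGaussianProcess Y P')
    (hmean : ∀ t, P[X t] = P'[Y t]) (hcov : ∀ s t, cov[X s, X t; P] = cov[Y s, Y t; P'])
    (J : Finset T) :
    P.map (fun ω => J.restrict (X · ω)) = P'.map (fun ω => J.restrict (Y · ω)) := by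
  have hXm : AEMeasurable (fun ω => J.restrict (X · ω)) P :=
    aemeasurable_pi_lambda _ fun _ => hX.aemeasurable _
  have hYm : AEMeasurable (fun ω => J.restrict (Y · ω)) P' :=
    aemeasurable_pi_lambda _ fun _ => hY.aemeasurable _
  have := hX.isProbabilityMeasure
  have := hY.isProbabilityMeasure
  have := (hX.hasGaussianLaw J).isGaussian_map
  have := (hY.hasGaussianLaw J).isGaussian_map
  -- The law is moved to Euclidean space, an inner product space, where a Gaussian measure is
  -- determined by its mean and covariance form.
  apply (MeasurableEquiv.toLp 2 (_ → ℝ)).map_measurableEquiv_injective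
  rw [MeasurableEquiv.coe_toLp, ← PiLp.coe_symm_continuousLinearEquiv 2 ℝ]
  apply IsGaussian.ext
  · rw [integral_map (by fun_prop) (by fun_prop), integral_map hXm (by fun_prop),
      integral_map (by fun_prop) (by fun_prop), integral_map hYm (by fun_prop)]
    simp only [id_eq]
    rw [ContinuousLinearEquiv.integral_comp_comm, ContinuousLinearEquiv.integral_comp_comm]
    congr 1
    ext i
    exact ((eval_integral (fun _ => (hX.hasGaussianLaw_eval _).integrable) i).trans (hmean i)).trans
      (eval_integral (fun _ => (hY.hasGaussianLaw_eval _).integrable) i).symm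
  · rw [← ContinuousLinearMap.toBilinForm_inj]
    refine LinearMap.BilinForm.ext_of_isSymm isPosSemidef_covarianceBilin.isSymm
      isPosSemidef_covarianceBilin.isSymm fun x => ?_
    simp only [ContinuousLinearMap.toBilinForm_apply]
    rw [PiLp.coe_symm_continuousLinearEquiv,
      AEMeasurable.map_map_of_aemeasurable (by fun_prop) hXm,
      AEMeasurable.map_map_of_aemeasurable (by fun_prop) hYm]
    have e1 := covarianceBilin_apply_pi (μ := P) (X := fun (i : J) ω => X i ω)
      (fun i => (hX.hasGaussianLaw_eval i).memLp_two) x x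
    have e2 := covarianceBilin_apply_pi (μ := P') (X := fun (i : J) ω => Y i ω)
      (fun i => (hY.hasGaussianLaw_eval i).memLp_two) x x
    refine (e1.trans ?_).trans e2.symm
    congrm ∑ i, ∑ j, _ * ?_
    exact hcov i j

/-- The law on `C([0,1], ℝ)` of a continuous Gaussian process is determined by its mean and
covariance functions. -/
theorem ProbabilityTheory.IsGaussianProcess.map_path_eq {Ω Ω' : Type*} [MeasurableSpace Ω]
    [MeasurableSpace Ω'] {P : Measure Ω} {P' : Measure Ω'} {X : Ω → C(I, ℝ)} {Y : Ω' → C(I, ℝ)}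
    (hXm : Measurable X) (hYm : Measurable Y)
    (hX : IsGaussianProcess (fun t ω => X ω t) P) (hY : IsGaussianProcess (fun t ω => Y ω t) P')
    (hmean : ∀ t, ∫ ω, X ω t ∂P = ∫ ω, Y ω t ∂P')
    (hcov : ∀ s t, cov[fun ω => X ω s, fun ω => X ω t; P] =
      cov[fun ω => Y ω s, fun ω => Y ω t; P']) :
    P.map X = P'.map Y := by
  have := hX.isProbabilityMeasure
  have := hY.isProbabilityMeasure
  have hE := measurableEmbedding_evalDense
  -- On `ℝ^ℕ` both images are projective limits of the same finite-dimensional laws, hence equal;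
  -- the embedding then pulls the equality back.
  have key : (P.map X).map evalDense = (P'.map Y).map evalDense := by
    rw [Measure.map_map hE.measurable hXm, Measure.map_map hE.measurable hYm]
    have e1 := isProjectiveLimit_map (P := P)
      (X := fun n ω => X ω (TopologicalSpace.denseSeq I n)) (hE.measurable.comp hXm).aemeasurable
    have e2 := isProjectiveLimit_map (P := P')
      (X := fun n ω => Y ω (TopologicalSpace.denseSeq I n)) (hE.measurable.comp hYm).aemeasurable
    have h3 := fun J => (hX.comp_right (TopologicalSpace.denseSeq I)).map_restrict_eq
      (hY.comp_right (TopologicalSpace.denseSeq I)) (fun n => hmean _) (fun n k => hcov _ _) J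
    have : ∀ J : Finset ℕ, IsFiniteMeasure
        (P'.map fun ω => J.restrict fun n => Y ω (TopologicalSpace.denseSeq I n)) :=
      fun J => inferInstance
    refine IsProjectiveLimit.unique (P := fun J : Finset ℕ =>
      P'.map fun ω => J.restrict fun n => Y ω (TopologicalSpace.denseSeq I n)) (fun J => ?_) e2
    exact (e1 J).trans (h3 J)
  rw [← hE.comap_map (P.map X), key, hE.comap_map]

end GaussianLaw

/-! ### Brownian motion as a Gaussian process -/

namespace IsBrownianMotion

variable {Ω : Type*} [MeasurableSpace Ω] {W : Ω → C(I, ℝ)} {Pr : Measure Ω}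

theorem measurable (hW : IsBrownianMotion W Pr) : Measurable W :=
  measurable_path hW.measurable_eval

theorem hasLaw_eval (hW : IsBrownianMotion W Pr) (t : I) :
    HasLaw (fun ω => W ω t) (gaussianReal 0 (Real.toNNReal t)) Pr := by
  have h := hW.gaussian 0 t t.2.1
  simp only [Set.Icc.coe_zero, sub_zero] at h
  refine h.congr ?_
  filter_upwards [hW.zero] with ω hω
  simp [hω]

theorem isGaussianProcess (hW : IsBrownianMotion W Pr) :
    IsGaussianProcess (fun t ω => W ω t) Pr :=
  hW.indep.isGaussianProcess (fun t => (hW.hasLaw_eval t).hasGaussianLaw) hW.zero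

theorem memLp_two (hW : IsBrownianMotion W Pr) (t : I) : MemLp (fun ω => W ω t) 2 Pr :=
  (hW.hasLaw_eval t).hasGaussianLaw.memLp_two

theorem integral_eval (hW : IsBrownianMotion W Pr) (t : I) : ∫ ω, W ω t ∂Pr = 0 := by
  rw [(hW.hasLaw_eval t).integral_eq, integral_id_gaussianReal]

theorem covariance_eval (hW : IsBrownianMotion W Pr) (s t : I) :
    cov[fun ω => W ω s, fun ω => W ω t; Pr] = min (s : ℝ) t := by
  wlog hst : s ≤ t generalizing s t
  · rw [covariance_comm, this t s (le_of_not_ge hst), min_comm]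
  have := (hW.hasLaw_eval 0).isProbabilityMeasure
  have h1 := hW.indep.indepFun_eval_sub (r := 0) s.2.1 hst hW.zero
  have h2 : (fun ω => W ω t) = (fun ω => W ω s) + ((fun ω => W ω t) - (fun ω => W ω s)) := by
    simp
  have hsub := (hW.memLp_two t).sub (hW.memLp_two s)
  rw [h2, covariance_add_right (hW.memLp_two s) (hW.memLp_two s) hsub,
    h1.covariance_eq_zero (hW.memLp_two s) hsub, covariance_self (hW.memLp_two s).aemeasurable,
    (hW.hasLaw_eval s).variance_eq, variance_id_gaussianReal, add_zero,
    Real.coe_toNNReal _ s.2.1, min_eq_left (by exact_mod_cast hst)]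

end IsBrownianMotion

/-! ### Linear combinations of independent Gaussian processes -/

section LinearCombination

variable {ι T Ω : Type*} [Fintype ι] [MeasurableSpace Ω] {P : Measure Ω} {X : ι → T → Ω → ℝ}

theorem isGaussianProcess_sum_mul (hX : ∀ i, IsGaussianProcess (X i) P)
    (hind : iIndepFun (fun i ω t => X i t ω) P) (v : ι → ℝ) :
    IsGaussianProcess (fun t ω => ∑ i, v i * X i t ω) P where
  hasGaussianLaw J := by
    have h := iIndepFun.hasGaussianLaw_fun_sum (P := P)
      (X := fun i ω => v i • J.restrict (X i · ω))
      (fun i => ((hX i).hasGaussianLaw J).fun_smul (v i))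
      (hind.comp (fun i u => v i • J.restrict u) fun i => by fun_prop)
    have he : (fun ω => J.restrict fun t => ∑ i, v i * X i t ω) =
        fun ω => ∑ i, v i • J.restrict (X i · ω) := by
      ext ω j
      simp
    rw [he]
    exact h

theorem integral_sum_mul_eq_zero (hX : ∀ i, IsGaussianProcess (X i) P)
    (hmean : ∀ i t, P[X i t] = 0) (v : ι → ℝ) (t : T) :
    ∫ ω, ∑ i, v i * X i t ω ∂P = 0 := by
  rw [integral_finsetSum _ fun i _ => ((hX i).hasGaussianLaw_eval t).integrable.const_mul _]
  refine Finset.sum_eq_zero fun i _ => ?_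
  rw [integral_const_mul, hmean, mul_zero]

theorem covariance_sum_mul (hX : ∀ i, IsGaussianProcess (X i) P)
    (hind : iIndepFun (fun i ω t => X i t ω) P) (v : ι → ℝ) {s t : T} {c : ℝ}
    (hcov : ∀ i, cov[X i s, X i t; P] = c) :
    cov[fun ω => ∑ i, v i * X i s ω, fun ω => ∑ i, v i * X i t ω; P] = (∑ i, v i ^ 2) * c := by
  classical
  have hL : ∀ i r, MemLp (X i r) 2 P := fun i r => ((hX i).hasGaussianLaw_eval r).memLp_two
  rcases isEmpty_or_nonempty ι with h | ⟨⟨i₀⟩⟩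
  · simp [covariance]
  have := (hX i₀).isProbabilityMeasure
  rw [covariance_fun_sum_fun_sum (fun i => (hL i s).const_mul _) (fun i => (hL i t).const_mul _),
    Finset.sum_mul]
  refine Finset.sum_congr rfl fun i _ => ?_
  rw [Finset.sum_eq_single i, covariance_const_mul_left, covariance_const_mul_right, hcov]
  · ring
  · intro j _ hj
    have hm : ∀ r, Measurable fun u : T → ℝ => u r := fun r => measurable_pi_apply r
    have h := (hind.indepFun hj.symm).comp (hm s) (hm t)
    have h0 : cov[X i s, X j t; P] = 0 := h.covariance_eq_zero (hL i s) (hL j t)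
    rw [covariance_const_mul_left, covariance_const_mul_right, h0]
    ring
  · simp

end LinearCombination

/-! ### Gaussian combinations with the law of a scaled Brownian motion -/

section ScaledBrownianMotion

variable {Ω Ω' : Type*} [MeasurableSpace Ω] [MeasurableSpace Ω'] {Pr : Measure Ω}
  {Pr' : Measure Ω'} {W : Ω → C(I, ℝ)}

/-- A continuous path whose values are linear combinations of independent centred Gaussian
processes with covariance `min s t` has the law of a multiple of a Brownian motion. -/
theorem IsBrownianMotion.map_smul_eq {ι : Type*} [Fintype ι] (hW : IsBrownianMotion W Pr)
    {X : ι → I → Ω' → ℝ} (hX : ∀ i, IsGaussianProcess (X i) Pr')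
    (hind : iIndepFun (fun i ω t => X i t ω) Pr') (hmean : ∀ i t, Pr'[X i t] = 0)
    (hcov : ∀ i s t, cov[X i s, X i t; Pr'] = min (s : ℝ) t) (v : ι → ℝ)
    {Y : Ω' → C(I, ℝ)} (hYm : Measurable Y) (hY : ∀ ω t, Y ω t = ∑ i, v i * X i t ω)
    {c : ℝ} (hc : ∑ i, v i ^ 2 = c ^ 2) :
    Pr'.map Y = Pr.map (fun ω => c • W ω) := by
  have hcW : IsGaussianProcess (fun t ω => (c • W ω) t) Pr := hW.isGaussianProcess.smul fun _ => c
  refine IsGaussianProcess.map_path_eq hYm (hW.measurable.const_smul c) ?_ hcW ?_ ?_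
  · simp_rw [hY]
    exact isGaussianProcess_sum_mul hX hind v
  · intro t
    simp_rw [hY, ContinuousMap.smul_apply, smul_eq_mul, integral_const_mul, hW.integral_eval]
    rw [integral_sum_mul_eq_zero hX hmean, mul_zero]
  · intro s t
    simp_rw [hY, ContinuousMap.smul_apply, smul_eq_mul]
    rw [covariance_sum_mul hX hind v fun i => hcov i s t, covariance_const_mul_left,
      covariance_const_mul_right, hW.covariance_eval, hc]
    ring

/-- `θᵀ A B` has the law of `‖θᵀ A‖₂ W`. -/
theorem IsBrownianMotionVec.map_projPath_matPath {d : ℕ} {B : Ω' → C(I, Vec d)}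
    (hB : IsBrownianMotionVec B Pr') (hW : IsBrownianMotion W Pr)
    (A : Matrix (Fin d) (Fin d) ℝ) (θ : Vec d) :
    Pr'.map (fun ω => projPath θ (matPath A (B ω))) =
      Pr.map (fun ω => ‖WithLp.toLp 2 (Matrix.vecMul θ.ofLp A)‖ • W ω) := by
  have hY : ∀ ω t, projPath θ (matPath A (B ω)) t =
      ∑ i, Matrix.vecMul θ.ofLp A i * B ω t i := by
    intro ω t
    change inner ℝ θ (Matrix.toEuclideanCLM (𝕜 := ℝ) A (B ω t)) = _
    rw [EuclideanSpace.inner_eq_star_dotProduct, Matrix.ofLp_toEuclideanCLM, dotProduct_comm]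
    simp only [star_trivial]
    rw [Matrix.dotProduct_mulVec]
    rfl
  refine hW.map_smul_eq (X := fun i t ω => B ω t i)
    (fun i => IsBrownianMotion.isGaussianProcess (hB.coord i))
    hB.indep (fun i => (hB.coord i).integral_eval) (fun i => (hB.coord i).covariance_eval)
    (Matrix.vecMul θ.ofLp A) (measurable_path fun t => ?_) hY ?_
  · simp_rw [hY]
    exact Finset.measurable_sum _ fun i _ => ((hB.coord i).measurable_eval t).const_mul _
  · simp [EuclideanSpace.norm_sq_eq]

end ScaledBrownianMotion

/-! ### Small balls -/

section SmallBall

variable {Ω : Type*} [MeasurableSpace Ω] {Pr : Measure Ω} {W : Ω → C(I, ℝ)}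

/-- By separability countably many `δ`-balls cover the space, so they cannot all be null. -/
theorem exists_measure_dist_lt_pos [NeZero Pr] {E : Type*} [PseudoMetricSpace E]
    [TopologicalSpace.SeparableSpace E] (W : Ω → E) {δ : ℝ} (hδ : 0 < δ) :
    ∃ φ, 0 < Pr {ω | dist (W ω) φ < δ} := by
  have : Nonempty E := by
    exact (Pr.nonempty_of_neZero).map W
  obtain ⟨n, hn⟩ := exists_measure_pos_of_not_measure_iUnion_null (μ := Pr)
    (s := fun n => {ω | dist (W ω) (TopologicalSpace.denseSeq E n) < δ}) <| by
      rw [Set.eq_univ_of_forall (s := ⋃ n, _)]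
      · exact (NeZero.ne' _).symm
      intro ω
      obtain ⟨n, hn⟩ := (TopologicalSpace.denseRange_denseSeq E).exists_dist_lt (W ω) hδ
      exact Set.mem_iUnion.2 ⟨n, hn⟩
  exact ⟨_, hn⟩

/-- Brownian motion stays in any ball around `0` with positive probability. -/
theorem IsBrownianMotion.measure_norm_lt_pos (hW : IsBrownianMotion W Pr) {δ : ℝ} (hδ : 0 < δ) :
    0 < Pr {ω | ‖W ω‖ < δ} := by
  have := hW.isGaussianProcess.isProbabilityMeasure
  obtain ⟨φ, hφ⟩ := exists_measure_dist_lt_pos (Pr := Pr) W (half_pos hδ)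
  -- Symmetrisation: the difference of two independent copies of `W` has the law of `√2 W`. If both
  -- copies fall in the same ball of radius `δ/2`, an event of squared positive probability, the
  -- difference has norm below `δ`.
  set Q : Measure (Fin 2 → Ω) := Measure.pi fun _ => Pr
  have hev : ∀ i, HasLaw (fun a : Fin 2 → Ω => a i) Pr Q := fun i =>
    (measurePreserving_eval (fun _ : Fin 2 => Pr) i).hasLaw
  have hlaw := hW.map_smul_eq (X := fun (i : Fin 2) t (a : Fin 2 → Ω) => W (a i) t) (Pr' := Q)
    (fun i => ⟨fun J => by
      refine ⟨?_⟩
      have h := (hW.isGaussianProcess.hasGaussianLaw J).isGaussian_map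
      rw [← (hev i).map_eq, AEMeasurable.map_map_of_aemeasurable _ (hev i).aemeasurable] at h
      · exact h
      · rw [(hev i).map_eq]
        exact (hW.isGaussianProcess.hasGaussianLaw J).aemeasurable⟩)
    (iIndepFun_pi (X := fun _ ω (t : I) => W ω t) fun i =>
      (measurable_pi_lambda _ hW.measurable_eval).aemeasurable)
    (fun i t => by
      rw [← hW.integral_eval t]
      exact (hev i).integral_comp (hW.measurable_eval t).aestronglyMeasurable)
    (fun i s t => by
      rw [← hW.covariance_eval s t]
      exact (hev i).covariance_fun_comp (hW.measurable_eval s).aemeasurable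
        (hW.measurable_eval t).aemeasurable)
    ![1, -1] (Y := fun a => W (a 0) - W (a 1))
    ((hW.measurable.comp (measurable_pi_apply 0)).sub (hW.measurable.comp (measurable_pi_apply 1)))
    (fun a t => by simp [Fin.sum_univ_two]; ring) (c := Real.sqrt 2) (by norm_num)
  have hset : MeasurableSet {ψ : C(I, ℝ) | ‖ψ‖ < δ} :=
    (isOpen_lt continuous_norm continuous_const).measurableSet
  have hpos : 0 < Q {a | ‖W (a 0) - W (a 1)‖ < δ} := by
    refine lt_of_lt_of_le ?_ (measure_mono (s := Set.univ.pi fun _ => {ω | dist (W ω) φ < δ / 2}) ?_)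
    · rw [Measure.pi_pi]
      simpa using ENNReal.pow_pos hφ 2
    · intro a ha
      have h0 : dist (W (a 0)) φ < δ / 2 := ha 0 trivial
      have h1 : dist (W (a 1)) φ < δ / 2 := ha 1 trivial
      change ‖W (a 0) - W (a 1)‖ < δ
      rw [← dist_eq_norm]
      linarith [dist_triangle_right (W (a 0)) (W (a 1)) φ]
  have hYm : Measurable fun a : Fin 2 → Ω => W (a 0) - W (a 1) :=
    (hW.measurable.comp (measurable_pi_apply 0)).sub (hW.measurable.comp (measurable_pi_apply 1))
  have hcm : Measurable fun ω => √2 • W ω := (measurable_const_smul √2).comp hW.measurable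
  have h := congrArg (fun μ => μ {ψ : C(I, ℝ) | ‖ψ‖ < δ}) hlaw
  rw [Measure.map_apply hYm hset, Measure.map_apply hcm hset] at h
  refine (hpos.trans_eq h).trans_le (measure_mono fun ω hω => ?_)
  change ‖√2 • W ω‖ < δ at hω
  change ‖W ω‖ < δ
  rw [norm_smul, Real.norm_eq_abs] at hω
  have : (1 : ℝ) ≤ |√2| := by
    rw [abs_of_nonneg (Real.sqrt_nonneg _)]
    exact Real.one_le_sqrt.2 one_le_two
  nlinarith [norm_nonneg (W ω)]

end SmallBall

/-! ### The functional `h_m` -/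

section HFun

/-- The bridge part `r ↦ φ(r) - r φ(1)` of a path. -/
def bridge (φ : C(I, ℝ)) : C(I, ℝ) := ⟨fun r => φ r - (r : ℝ) * φ 1, by fun_prop⟩

theorem bridge_apply (φ : C(I, ℝ)) (r : I) : bridge φ r = φ r - (r : ℝ) * φ 1 := rfl

theorem hFun_bridge (m : ℕ) (φ : C(I, ℝ)) : hFun m (bridge φ) = hFun m φ := by
  simp [hFun, bridge_apply]

theorem continuous_memLp (φ : C(I, ℝ)) (p : ℝ≥0∞) : MemLp φ p (volume : Measure I) :=
  MemLp.of_bound φ.continuous.aestronglyMeasurable ‖φ‖ (.of_forall φ.norm_coe_le_norm)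

/-- Needed so that a continuous function vanishing almost everywhere vanishes everywhere. A
relatively open set around an endpoint still meets the open interval. -/
theorem isOpenPosMeasure_unitInterval : (volume : Measure I).IsOpenPosMeasure where
  open_pos U hU hne := by
    obtain ⟨V, hV, rfl⟩ := isOpen_induced_iff.1 hU
    obtain ⟨x, hx⟩ := hne
    have hx' : (x : ℝ) ∈ closure (Set.Ioo (0 : ℝ) 1) := by
      rw [closure_Ioo zero_ne_one]
      exact x.2
    have hpos := (hV.inter isOpen_Ioo).measure_pos volume (mem_closure_iff.1 hx' V hV hx)
    have he : (volume : Measure I) (Subtype.val ⁻¹' V) = volume (V ∩ Set.Icc (0 : ℝ) 1) := by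
      rw [Set.inter_comm, ← Subtype.image_preimage_coe, ← comap_subtype_coe_apply measurableSet_Icc]
      rfl
    rw [he]
    exact (hpos.trans_le (measure_mono (by gcongr; exact Set.Ioo_subset_Icc_self))).ne'

variable {m : ℕ}

theorem hFun_eq_eLpNorm (hm : 1 ≤ m) (φ : C(I, ℝ)) :
    hFun m φ = (eLpNorm (bridge φ) m volume).toReal := by
  have hm0 : (m : ℝ≥0∞) ≠ 0 := by exact_mod_cast (Nat.one_le_iff_ne_zero.1 hm)
  rw [(continuous_memLp (bridge φ) m).eLpNorm_eq_integral_rpow_norm hm0 (ENNReal.natCast_ne_top m),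
    ENNReal.toReal_ofReal (by positivity)]
  simp [hFun, bridge_apply]

theorem hFun_nonneg (m : ℕ) (φ : C(I, ℝ)) : 0 ≤ hFun m φ := by
  unfold hFun
  positivity

/-- Minkowski's inequality for the bridges. The constant `2` arises because the bridge of `φ - ψ`
has sup norm at most `2‖φ - ψ‖`, and the time interval has total mass `1`. -/
theorem hFun_le_add (hm : 1 ≤ m) (φ ψ : C(I, ℝ)) : hFun m φ ≤ hFun m ψ + 2 * dist φ ψ := by
  rw [hFun_eq_eLpNorm hm, hFun_eq_eLpNorm hm]
  have hb : ⇑(bridge φ) = ⇑(bridge ψ) + ⇑(bridge (φ - ψ)) := by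
    ext r
    simp only [Pi.add_apply, bridge_apply, ContinuousMap.sub_apply]
    ring
  have h1 : eLpNorm (bridge φ) m volume ≤
      eLpNorm (bridge ψ) m volume + eLpNorm (bridge (φ - ψ)) m volume := by
    rw [hb]
    exact eLpNorm_add_le (bridge ψ).continuous.aestronglyMeasurable
      (bridge (φ - ψ)).continuous.aestronglyMeasurable (by exact_mod_cast hm)
  have h2 : eLpNorm (bridge (φ - ψ)) m (volume : Measure I) ≤ ENNReal.ofReal (2 * dist φ ψ) := by
    refine (eLpNorm_le_of_ae_bound (C := 2 * dist φ ψ) (.of_forall fun r => ?_)).trans (by simp)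
    rw [dist_eq_norm, bridge_apply]
    have hr := r.2
    calc ‖(φ - ψ) r - (r : ℝ) * (φ - ψ) 1‖ ≤ ‖(φ - ψ) r‖ + ‖(r : ℝ) * (φ - ψ) 1‖ := norm_sub_le _ _
      _ ≤ ‖φ - ψ‖ + 1 * ‖φ - ψ‖ := by
        rw [norm_mul]
        gcongr
        · exact (φ - ψ).norm_coe_le_norm r
        · rw [Real.norm_eq_abs, abs_of_nonneg hr.1]
          exact hr.2
        · exact (φ - ψ).norm_coe_le_norm 1
      _ = 2 * ‖φ - ψ‖ := by ring
  have hψ := (continuous_memLp (bridge ψ) m).eLpNorm_ne_top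
  calc (eLpNorm (bridge φ) m volume).toReal
      ≤ (eLpNorm (bridge ψ) m volume + ENNReal.ofReal (2 * dist φ ψ)).toReal :=
        ENNReal.toReal_mono (by finiteness) (h1.trans (by gcongr))
    _ = _ := by
      rw [ENNReal.toReal_add hψ ENNReal.ofReal_ne_top, ENNReal.toReal_ofReal (by positivity)]

theorem continuous_hFun (hm : 1 ≤ m) : Continuous (hFun m) :=
  (LipschitzWith.of_le_add_mul 2 fun φ ψ => by simpa using hFun_le_add hm φ ψ).continuous

theorem measurable_fFun (hm : 1 ≤ m) : Measurable (fFun m) :=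
  (continuous_eval_const (1 : I)).measurable.div (continuous_hFun hm).measurable

theorem hFun_smul (hm : 1 ≤ m) {c : ℝ} (hc : 0 ≤ c) (φ : C(I, ℝ)) :
    hFun m (c • φ) = c * hFun m φ := by
  rw [hFun_eq_eLpNorm hm, hFun_eq_eLpNorm hm]
  have hb : ⇑(bridge (c • φ)) = c • ⇑(bridge φ) := by
    ext r
    simp only [Pi.smul_apply, bridge_apply, ContinuousMap.smul_apply, smul_eq_mul]
    ring
  rw [hb, eLpNorm_const_smul, ENNReal.toReal_mul]
  simp [abs_of_nonneg hc]

theorem fFun_smul (hm : 1 ≤ m) {c : ℝ} (hc : 0 < c) (φ : C(I, ℝ)) :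
    fFun m (c • φ) = fFun m φ := by
  unfold fFun
  rw [hFun_smul hm hc.le, ContinuousMap.smul_apply, smul_eq_mul, mul_div_mul_left _ _ hc.ne']

theorem hFun_le_norm (hm : 1 ≤ m) (φ : C(I, ℝ)) : hFun m φ ≤ 2 * ‖φ‖ := by
  have h := hFun_le_add hm φ 0
  have h0 : hFun m (0 : C(I, ℝ)) = 0 := by
    simpa using hFun_smul hm le_rfl (0 : C(I, ℝ))
  simpa [h0] using h

theorem bridge_eq_zero_of_hFun_eq_zero (hm : 1 ≤ m) {φ : C(I, ℝ)} (h : hFun m φ = 0) (r : I) :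
    bridge φ r = 0 := by
  rw [hFun_eq_eLpNorm hm, ENNReal.toReal_eq_zero_iff,
    or_iff_left (continuous_memLp (bridge φ) m).eLpNorm_ne_top,
    eLpNorm_eq_zero_iff (bridge φ).continuous.aestronglyMeasurable
      (by exact_mod_cast (Nat.one_le_iff_ne_zero.1 hm))] at h
  have := isOpenPosMeasure_unitInterval
  exact congrFun ((bridge φ).continuous.ae_eq_iff_eq volume continuous_zero |>.1 h) r

/-- From `a ≤ 1 + a^m`: the `m`-th root is removed, so that Tonelli's theorem applies to the
expectation. -/
theorem ofReal_hFun_le (hm : 1 ≤ m) (φ : C(I, ℝ)) :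
    ENNReal.ofReal (hFun m φ) ≤ 1 + ∫⁻ r : I, ‖bridge φ r‖ₑ ^ m := by
  have hm0 : m ≠ 0 := Nat.one_le_iff_ne_zero.1 hm
  have h1 : ENNReal.ofReal (hFun m φ) = eLpNorm (bridge φ) m volume := by
    rw [hFun_eq_eLpNorm hm, ENNReal.ofReal_toReal (continuous_memLp (bridge φ) m).eLpNorm_ne_top]
  have h2 : eLpNorm (bridge φ) m volume ^ m = ∫⁻ r : I, ‖bridge φ r‖ₑ ^ m := by
    rw [eLpNorm_eq_lintegral_rpow_enorm_toReal (by exact_mod_cast hm0) (ENNReal.natCast_ne_top m)]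
    simp only [ENNReal.toReal_natCast, one_div, ENNReal.rpow_natCast]
    rw [← ENNReal.rpow_natCast, ← ENNReal.rpow_mul, inv_mul_cancel₀ (by exact_mod_cast hm0),
      ENNReal.rpow_one]
  rw [h1, ← h2]
  rcases le_total (eLpNorm (bridge φ) m (volume : Measure I)) 1 with h | h
  · exact h.trans le_self_add
  · exact (le_self_pow₀ h hm0).trans le_add_self

end HFun

/-! ### The ratio `W(1) / h_m(W)` -/

section Ratio

variable {Ω : Type*} [MeasurableSpace Ω] {Pr : Measure Ω} {W : Ω → C(I, ℝ)} {m : ℕ}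

theorem ENNReal.add_pow_le_two_pow_mul (a b : ℝ≥0∞) (m : ℕ) : (a + b) ^ m ≤ 2 ^ m * (a ^ m + b ^ m) := by
  wlog h : a ≤ b generalizing a b
  · rw [add_comm a, add_comm (a ^ m)]
    exact this b a (le_of_not_ge h)
  calc (a + b) ^ m ≤ (2 * b) ^ m := by
        rw [two_mul]
        gcongr
    _ = 2 ^ m * b ^ m := mul_pow _ _ _
    _ ≤ _ := by
        gcongr
        exact le_add_self

theorem measurable_bridge : Measurable bridge := by
  refine measurable_path fun t => ?_
  exact ((continuous_eval_const t).sub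
    (continuous_const.mul (continuous_eval_const (1 : I)))).measurable

/-- `W(1)` and the bridge are jointly Gaussian with covariance `t - t · 1 = 0`. -/
theorem IsBrownianMotion.indepFun_bridge (hW : IsBrownianMotion W Pr) :
    IndepFun (fun ω => W ω 1) (fun ω => bridge (W ω)) Pr := by
  have := hW.isGaussianProcess.isProbabilityMeasure
  refine IndepFun.path_of_eval ?_
  -- `W(1)` is viewed as a process indexed by a point, to fit the criterion for jointly Gaussian
  -- processes.
  have h : IndepFun (fun ω (_ : Unit) => W ω 1) (fun ω (t : I) => bridge (W ω) t) Pr := by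
    refine IsGaussianProcess.indepFun_of_covariance_eq_zero
      (X := fun (_ : Unit) ω => W ω 1) (Y := fun (t : I) ω => bridge (W ω) t) ?_
      (fun _ => (hW.measurable_eval 1).aemeasurable)
      (fun t => ((hW.measurable_eval t).sub
        ((hW.measurable_eval 1).const_mul _)).aemeasurable) ?_
    · classical
      refine hW.isGaussianProcess.of_isGaussianProcess ?_
      rintro (u | t)
      · exact ⟨{1}, .proj ⟨1, by simp⟩, fun ω => rfl⟩
      · exact ⟨{t, 1}, .proj ⟨t, by simp⟩ - (t : ℝ) • .proj ⟨1, by simp⟩, fun ω => rfl⟩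
    · intro _ t
      change cov[fun ω => W ω 1, fun ω => W ω t - (t : ℝ) * W ω 1; Pr] = 0
      rw [covariance_fun_sub_right (hW.memLp_two 1) (hW.memLp_two t)
        ((hW.memLp_two 1).const_mul _), covariance_const_mul_right, hW.covariance_eval,
        hW.covariance_eval]
      simp [min_eq_right t.2.2]
  exact h.comp (φ := fun u : Unit → ℝ => u ()) (measurable_pi_apply ()) measurable_id

theorem IsBrownianMotion.indepFun_hFun (hW : IsBrownianMotion W Pr) (hm : 1 ≤ m) :
    IndepFun (fun ω => hFun m (W ω)) (fun ω => W ω 1) Pr := by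
  have h := hW.indepFun_bridge.symm.comp (continuous_hFun hm).measurable measurable_id
  simpa [Function.comp_def, hFun_bridge] using h

theorem IsBrownianMotion.measurable_hFun (hW : IsBrownianMotion W Pr) (hm : 1 ≤ m) :
    Measurable fun ω => hFun m (W ω) :=
  (continuous_hFun hm).measurable.comp hW.measurable

/-- A zero of `h_m` forces the whole bridge to vanish, but at time `1/2` the bridge is Gaussian with
variance `1/4`. -/
theorem IsBrownianMotion.hFun_pos (hW : IsBrownianMotion W Pr) (hm : 1 ≤ m) :
    ∀ᵐ ω ∂Pr, 0 < hFun m (W ω) := by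
  have := hW.isGaussianProcess.isProbabilityMeasure
  let c : I := ⟨1 / 2, by norm_num, by norm_num⟩
  -- the midpoint of the bridge is a nondegenerate Gaussian variable
  have hL : MemLp (fun ω => bridge (W ω) c) 2 Pr :=
    (hW.memLp_two c).sub ((hW.memLp_two 1).const_mul _)
  have hG : HasGaussianLaw (fun ω => bridge (W ω) c) Pr := by
    classical
    exact (hW.isGaussianProcess.of_isGaussianProcess (Y := fun (_ : Unit) ω => bridge (W ω) c)
      fun _ => ⟨{c, 1}, .proj ⟨c, by simp⟩ - (c : ℝ) • .proj ⟨1, by simp⟩,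
        fun ω => rfl⟩).hasGaussianLaw_eval ()
  have hvar : Var[fun ω => bridge (W ω) c; Pr] = 1 / 4 := by
    rw [← covariance_self hL.aemeasurable]
    change cov[fun ω => W ω c - (c : ℝ) * W ω 1, fun ω => W ω c - (c : ℝ) * W ω 1; Pr] = _
    rw [covariance_fun_sub_fun_sub (hW.memLp_two c) ((hW.memLp_two 1).const_mul _)
      (hW.memLp_two c) ((hW.memLp_two 1).const_mul _), covariance_const_mul_right,
      covariance_const_mul_left, covariance_const_mul_left, covariance_const_mul_right]
    simp only [hW.covariance_eval]
    simp [c]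
    norm_num
  have hnull : NullSingletonClass (Pr.map fun ω => bridge (W ω) c) := by
    rw [hG.map_eq_gaussianReal, hvar]
    exact nullSingletonClass_gaussianReal (by norm_num)
  have hne : ∀ᵐ ω ∂Pr, bridge (W ω) c ≠ 0 :=
    ae_of_ae_map hL.aemeasurable (Measure.ae_ne _ 0)
  filter_upwards [hne] with ω hω
  exact (hFun_nonneg m _).lt_of_ne' fun h => hω (bridge_eq_zero_of_hFun_eq_zero hm h c)

/-- `W(t)` has the law of `√t` times a standard Gaussian, and `√t ≤ 1`; the bound is uniform in `t`.
-/
theorem IsBrownianMotion.lintegral_eval_pow_le (hW : IsBrownianMotion W Pr) (t : I) (m : ℕ) :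
    ∫⁻ ω, ‖W ω t‖ₑ ^ m ∂Pr ≤ ∫⁻ y, ‖y‖ₑ ^ m ∂(gaussianReal 0 1) := by
  have h1 : gaussianReal 0 (Real.toNNReal t) = (gaussianReal 0 1).map (√(t : ℝ) * ·) := by
    rw [gaussianReal_map_const_mul]
    congr 1
    · simp
    · ext
      simp [t.2.1]
  rw [(hW.hasLaw_eval t).lintegral_comp (f := fun y => ‖y‖ₑ ^ m) (by fun_prop), h1,
    lintegral_map (by fun_prop) (by fun_prop)]
  refine lintegral_mono fun y => ?_
  gcongr
  rw [enorm_le_iff_norm_le, norm_mul, Real.norm_eq_abs, abs_of_nonneg (Real.sqrt_nonneg _)]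
  exact mul_le_of_le_one_left (norm_nonneg _) (Real.sqrt_le_one.2 t.2.2)

theorem lintegral_enorm_pow_gaussianReal_lt_top (m : ℕ) :
    ∫⁻ y, ‖y‖ₑ ^ m ∂(gaussianReal 0 1) < ∞ := by
  rcases eq_or_ne m 0 with rfl | hm
  · simp
  have h := (memLp_id_gaussianReal (μ := 0) (v := 1) m).eLpNorm_lt_top
  have := lintegral_rpow_enorm_lt_top_of_eLpNorm_lt_top (p := (m : ℝ≥0∞))
    (by exact_mod_cast hm) (ENNReal.natCast_ne_top m) (by simpa using h)
  simpa using this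

theorem IsBrownianMotion.integrable_hFun (hW : IsBrownianMotion W Pr) (hm : 1 ≤ m) :
    Integrable (fun ω => hFun m (W ω)) Pr := by
  have := hW.isGaussianProcess.isProbabilityMeasure
  refine ⟨(hW.measurable_hFun hm).aestronglyMeasurable, ?_⟩
  rw [hasFiniteIntegral_iff_ofReal (.of_forall fun ω => hFun_nonneg m _)]
  set K := ∫⁻ y, ‖y‖ₑ ^ m ∂(gaussianReal 0 1)
  have hjoint : Measurable fun q : Ω × I => ‖bridge (W q.1) q.2‖ₑ ^ m := by
    have h : Measurable fun q : Ω × I => bridge (W q.1) q.2 :=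
      (continuous_eval (F := C(I, ℝ))).measurable.comp
        (((measurable_bridge.comp hW.measurable).comp measurable_fst).prodMk measurable_snd)
    fun_prop
  have hb : ∀ t : I, ∫⁻ ω, ‖bridge (W ω) t‖ₑ ^ m ∂Pr ≤ 2 ^ m * (K + K) := by
    intro t
    calc ∫⁻ ω, ‖bridge (W ω) t‖ₑ ^ m ∂Pr
        ≤ ∫⁻ ω, 2 ^ m * (‖W ω t‖ₑ ^ m + ‖W ω 1‖ₑ ^ m) ∂Pr := by
          refine lintegral_mono fun ω => ?_
          refine (pow_le_pow_left₀ (by positivity) ?_ m).trans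
            (ENNReal.add_pow_le_two_pow_mul _ _ m)
          rw [bridge_apply]
          refine enorm_sub_le.trans ?_
          gcongr
          rw [enorm_le_iff_norm_le, norm_mul, Real.norm_eq_abs, abs_of_nonneg t.2.1]
          exact mul_le_of_le_one_left (norm_nonneg _) t.2.2
      _ = 2 ^ m * (∫⁻ ω, ‖W ω t‖ₑ ^ m ∂Pr + ∫⁻ ω, ‖W ω 1‖ₑ ^ m ∂Pr) := by
          have := hW.measurable_eval t
          have := hW.measurable_eval 1
          rw [lintegral_const_mul _ (by fun_prop), lintegral_add_left (by fun_prop)]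
      _ ≤ _ := by
          gcongr
          · exact hW.lintegral_eval_pow_le t m
          · exact hW.lintegral_eval_pow_le 1 m
  have hK : K < ∞ := lintegral_enorm_pow_gaussianReal_lt_top m
  calc ∫⁻ ω, ENNReal.ofReal (hFun m (W ω)) ∂Pr
      ≤ ∫⁻ ω, (1 + ∫⁻ r : I, ‖bridge (W ω) r‖ₑ ^ m) ∂Pr :=
        lintegral_mono fun ω => ofReal_hFun_le hm (W ω)
    _ = 1 + ∫⁻ r : I, ∫⁻ ω, ‖bridge (W ω) r‖ₑ ^ m ∂Pr := by
        rw [lintegral_add_left (by fun_prop), lintegral_lintegral_swap hjoint.aemeasurable]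
        simp
    _ ≤ 1 + ∫⁻ _ : I, 2 ^ m * (K + K) := by
        gcongr with r
        exact hb r
    _ < ∞ := by
        simp only [lintegral_const, measure_univ, mul_one]
        finiteness

end Ratio

/-! ### The density of a Gaussian ratio -/

section GaussianRatio

variable {Ω : Type*} [MeasurableSpace Ω] {Pr : Measure Ω} {H Z : Ω → ℝ}

/-- The density of `Z / H`, where `Z` is a standard Gaussian variable independent of `H > 0`. -/
noncomputable def gaussianRatioDensity (H : Ω → ℝ) (Pr : Measure Ω) (y : ℝ) : ℝ :=
  ∫ ω, H ω * gaussianPDFReal 0 1 (H ω * y) ∂Pr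

theorem gaussianPDFReal_zero_one_le_one (y : ℝ) : gaussianPDFReal 0 1 y ≤ 1 := by
  rw [gaussianPDFReal_def]
  refine mul_le_one₀ (inv_le_one_of_one_le₀ (Real.one_le_sqrt.2 ?_)) (Real.exp_nonneg _)
    (Real.exp_le_one_iff.2 ?_)
  · simp only [NNReal.coe_one, mul_one]
    linarith [Real.pi_gt_three]
  · simp only [sub_zero, NNReal.coe_one, mul_one]
    exact div_nonpos_of_nonpos_of_nonneg (neg_nonpos.2 (sq_nonneg y)) zero_le_two

theorem continuous_gaussianPDFReal_zero_one : Continuous (gaussianPDFReal 0 1) := by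
  rw [gaussianPDFReal_def]
  fun_prop

theorem gaussianRatioDensity_nonneg (hpos : ∀ᵐ ω ∂Pr, 0 < H ω) (y : ℝ) :
    0 ≤ gaussianRatioDensity H Pr y := by
  refine integral_nonneg_of_ae ?_
  filter_upwards [hpos] with ω hω
  exact mul_nonneg hω.le (gaussianPDFReal_nonneg _ _ _)

theorem gaussianRatioDensity_neg (y : ℝ) :
    gaussianRatioDensity H Pr (-y) = gaussianRatioDensity H Pr y := by
  simp [gaussianRatioDensity, gaussianPDFReal]

theorem norm_mul_gaussianPDFReal_le (h y : ℝ) : ‖h * gaussianPDFReal 0 1 (h * y)‖ ≤ ‖h‖ := by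
  rw [norm_mul]
  refine mul_le_of_le_one_right (norm_nonneg _) ?_
  rw [Real.norm_of_nonneg (gaussianPDFReal_nonneg _ _ _)]
  exact gaussianPDFReal_zero_one_le_one _

theorem integrable_mul_gaussianPDFReal (hint : Integrable H Pr) (y : ℝ) :
    Integrable (fun ω => H ω * gaussianPDFReal 0 1 (H ω * y)) Pr :=
  hint.mono (hint.1.mul (continuous_gaussianPDFReal_zero_one.comp_aestronglyMeasurable
    (hint.1.mul_const y))) (.of_forall fun _ => norm_mul_gaussianPDFReal_le _ _)

theorem continuous_gaussianRatioDensity (hint : Integrable H Pr) :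
    Continuous (gaussianRatioDensity H Pr) := by
  refine continuous_of_dominated (bound := fun ω => ‖H ω‖)
    (fun y => (integrable_mul_gaussianPDFReal hint y).1)
    (fun y => .of_forall fun ω => norm_mul_gaussianPDFReal_le _ _) hint.norm
    (.of_forall fun ω => ?_)
  have := continuous_gaussianPDFReal_zero_one
  fun_prop

/-- For fixed `h`, the quotient of a standard Gaussian by `h` has variance `1/h²` and density `h φ(h
y)`. -/
theorem gaussianReal_preimage_div {h : ℝ} (hh : 0 < h) {A : Set ℝ} (hA : MeasurableSet A) :
    gaussianReal 0 1 ((· / h) ⁻¹' A) =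
      ∫⁻ y in A, ENNReal.ofReal (h * gaussianPDFReal 0 1 (h * y)) := by
  rw [← Measure.map_apply (by fun_prop) hA, gaussianReal_map_div_const,
    gaussianReal_apply _ (by
      rw [← NNReal.coe_ne_zero]
      simpa using hh.ne')]
  refine lintegral_congr fun y => ?_
  rw [gaussianPDF_def]
  simp only [gaussianPDFReal, zero_div, sub_zero, NNReal.coe_div, NNReal.coe_one, NNReal.coe_mk,
    mul_one]
  rw [Real.sqrt_mul' _ (by positivity), Real.sqrt_div zero_le_one, Real.sqrt_one,
    Real.sqrt_sq hh.le]
  have : -y ^ 2 / (2 * (1 / h ^ 2)) = -(h * y) ^ 2 / 2 := by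
    field_simp
  rw [this]
  field_simp

/-- Conditioning on `H` reduces to a deterministic denominator; Tonelli then averages the
conditional densities. -/
theorem map_div_eq_withDensity [IsProbabilityMeasure Pr] (hHm : Measurable H)
    (hZm : Measurable Z) (hpos : ∀ᵐ ω ∂Pr, 0 < H ω) (hint : Integrable H Pr)
    (hind : IndepFun H Z Pr) (hZ : Pr.map Z = gaussianReal 0 1) :
    Pr.map (fun ω => Z ω / H ω) =
      volume.withDensity fun y => ENNReal.ofReal (gaussianRatioDensity H Pr y) := by
  ext A hA
  have hset : MeasurableSet {q : ℝ × ℝ | q.2 / q.1 ∈ A} :=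
    (measurable_snd.div measurable_fst) hA
  have hdiv : Measurable fun ω => Z ω / H ω := hZm.div hHm
  have hpdf := continuous_gaussianPDFReal_zero_one.measurable
  calc Pr.map (fun ω => Z ω / H ω) A
      = Pr.map (fun ω => (H ω, Z ω)) {q : ℝ × ℝ | q.2 / q.1 ∈ A} := by
        rw [Measure.map_apply hdiv hA, Measure.map_apply (hHm.prodMk hZm) hset]
        rfl
    _ = ∫⁻ ω, gaussianReal 0 1 ((· / H ω) ⁻¹' A) ∂Pr := by
        rw [(indepFun_iff_map_prod_eq_prod_map_map hHm.aemeasurable hZm.aemeasurable).1 hind,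
          hZ, Measure.prod_apply hset, lintegral_map (measurable_measure_prodMk_left hset) hHm]
        rfl
    _ = ∫⁻ ω, (∫⁻ y : ℝ in A, ENNReal.ofReal (H ω * gaussianPDFReal 0 1 (H ω * y))) ∂Pr := by
        refine lintegral_congr_ae ?_
        filter_upwards [hpos] with ω hω
        exact gaussianReal_preimage_div hω hA
    _ = ∫⁻ y : ℝ in A, ∫⁻ ω, ENNReal.ofReal (H ω * gaussianPDFReal 0 1 (H ω * y)) ∂Pr :=
        lintegral_lintegral_swap (by fun_prop)
    _ = ∫⁻ y in A, ENNReal.ofReal (gaussianRatioDensity H Pr y) := by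
        refine lintegral_congr fun y => ?_
        rw [gaussianRatioDensity, ofReal_integral_eq_lintegral_ofReal
          (integrable_mul_gaussianPDFReal hint y)]
        filter_upwards [hpos] with ω hω
        exact mul_nonneg hω.le (gaussianPDFReal_nonneg _ _ _)
    _ = _ := (withDensity_apply _ hA).symm

end GaussianRatio

section RatioDensity

variable {Ω : Type*} [MeasurableSpace Ω] {Pr : Measure Ω} {W : Ω → C(I, ℝ)} {m : ℕ}

theorem IsBrownianMotion.map_fFun (hW : IsBrownianMotion W Pr) (hm : 1 ≤ m) :
    Pr.map (fun ω => fFun m (W ω)) = volume.withDensity fun y =>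
      ENNReal.ofReal (gaussianRatioDensity (fun ω => hFun m (W ω)) Pr y) := by
  have := hW.isGaussianProcess.isProbabilityMeasure
  refine map_div_eq_withDensity (hW.measurable_hFun hm) (hW.measurable_eval 1) (hW.hFun_pos hm)
    (hW.integrable_hFun hm) (hW.indepFun_hFun hm) ?_
  simpa using (hW.hasLaw_eval 1).map_eq

end RatioDensity

/-! ### Comparison of rejection probabilities in Lévy–Prokhorov distance -/

section LevyProkhorov

theorem measureReal_le_of_levyProkhorovDist_lt {E : Type*} [PseudoMetricSpace E]
    [MeasurableSpace E] {μ ν : Measure E} [IsFiniteMeasure μ] [IsFiniteMeasure ν] {δ : ℝ}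
    (h : levyProkhorovDist μ ν < δ) {A : Set E} (hA : MeasurableSet A) :
    μ.real A ≤ ν.real (Metric.thickening δ A) + δ := by
  have hδ : 0 ≤ δ := ENNReal.toReal_nonneg.trans h.le
  have h' : levyProkhorovEDist μ ν < ENNReal.ofReal δ :=
    (ENNReal.lt_ofReal_iff_toReal_lt (levyProkhorovEDist_ne_top μ ν)).2 h
  have key := left_measure_le_of_levyProkhorovEDist_lt h' hA
  rw [ENNReal.toReal_ofReal hδ] at key
  calc μ.real A ≤ (ν (Metric.thickening δ A) + ENNReal.ofReal δ).toReal :=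
        ENNReal.toReal_mono (by finiteness) key
    _ = _ := by
      rw [ENNReal.toReal_add (by finiteness) (by finiteness), ENNReal.toReal_ofReal hδ]
      rfl

end LevyProkhorov

/-! ### Stability of `|f_m|` under uniform perturbations -/

section Perturbation

variable {m : ℕ} {φ ψ : C(I, ℝ)} {x y δ : ℝ}

theorem abs_apply_one_sub_le_dist (φ ψ : C(I, ℝ)) : |φ 1| ≤ |ψ 1| + dist φ ψ := by
  have h := ContinuousMap.dist_apply_le_dist (f := φ) (g := ψ) 1
  rw [Real.dist_eq] at h
  linarith [abs_sub_abs_le_abs_sub (φ 1) (ψ 1)]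

theorem abs_fFun (m : ℕ) (φ : C(I, ℝ)) : |fFun m φ| = |φ 1| / hFun m φ := by
  rw [fFun, abs_div, abs_of_nonneg (hFun_nonneg m φ)]

/-- `|ψ(1)| ≥ |φ(1)| - δ > x h_m(φ) - δ ≥ x h_m(ψ) - (1 + 2x) δ`; division by `h_m(ψ) > y` gives the
constant. -/
theorem le_abs_fFun_of_dist_lt (hm : 1 ≤ m) (hx : 0 < x) (hy : 0 < y) (hd : dist ψ φ < δ)
    (hφ : x < |fFun m φ|) (hψ : y < hFun m ψ) : x - (1 + 2 * x) / y * δ ≤ |fFun m ψ| := by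
  have hφ0 : 0 < hFun m φ := by
    -- A vanishing denominator would give `f_m(φ) = 0` by convention, contradicting `x < |f_m(φ)|`.
    refine (hFun_nonneg m φ).lt_of_ne' fun h => ?_
    rw [abs_fFun, h, div_zero] at hφ
    exact hx.not_gt hφ
  rw [abs_fFun, lt_div_iff₀ hφ0] at hφ
  have hδ : 0 < δ := dist_nonneg.trans_lt hd
  have hψ0 : 0 < hFun m ψ := hy.trans hψ
  have h1 := hFun_le_add hm ψ φ
  have h2 := abs_apply_one_sub_le_dist φ ψ
  rw [dist_comm] at h2
  have h3 : (1 + 2 * x) / hFun m ψ * δ ≤ (1 + 2 * x) / y * δ := by gcongr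
  have h4 : x - (1 + 2 * x) / hFun m ψ * δ ≤ |fFun m ψ| := by
    rw [abs_fFun, le_div_iff₀ hψ0]
    have : (x - (1 + 2 * x) / hFun m ψ * δ) * hFun m ψ = x * hFun m ψ - (1 + 2 * x) * δ := by
      field_simp
    rw [this]
    nlinarith
  linarith

/-- The mirror estimate. Here `2δ ≤ y` keeps `h_m(φ)` positive; otherwise the default value `f_m(φ)
= 0` would satisfy the hypothesis with no control on `φ(1)`. -/
theorem abs_fFun_le_of_dist_lt (hm : 1 ≤ m) (hx : 0 < x) (hy : 0 < y) (hd : dist ψ φ < δ)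
    (hδy : 2 * δ ≤ y) (hφ : |fFun m φ| ≤ x) (hψ : y < hFun m ψ) :
    |fFun m ψ| ≤ x + (1 + 2 * x) / y * δ := by
  have hδ : 0 < δ := dist_nonneg.trans_lt hd
  have hψ0 : 0 < hFun m ψ := hy.trans hψ
  have h1 := hFun_le_add hm φ ψ
  have h1' := hFun_le_add hm ψ φ
  have h2 := abs_apply_one_sub_le_dist ψ φ
  rw [dist_comm] at h1
  have hφ0 : 0 < hFun m φ := by linarith
  rw [abs_fFun, div_le_iff₀ hφ0] at hφ
  have h3 : (1 + 2 * x) / hFun m ψ * δ ≤ (1 + 2 * x) / y * δ := by gcongr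
  have h4 : |fFun m ψ| ≤ x + (1 + 2 * x) / hFun m ψ * δ := by
    rw [abs_fFun, div_le_iff₀ hψ0]
    have : (x + (1 + 2 * x) / hFun m ψ * δ) * hFun m ψ = x * hFun m ψ + (1 + 2 * x) * δ := by
      field_simp
    rw [this]
    nlinarith
  linarith

end Perturbation

/-! ### The comparison bound and its continuity -/

section Comparison

variable {Ω Ω₀ : Type*} [MeasurableSpace Ω] [MeasurableSpace Ω₀] {Pr : Measure Ω}
  {Pr₀ : Measure Ω₀} {W : Ω₀ → C(I, ℝ)} {X : Ω → C(I, ℝ)} {m : ℕ}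

/-- The larger of the two probabilities that `h_m(W)` is at most `z` while `|f_m(W)|` lies on a
given side of `x`. -/
noncomputable def smallDenominatorProb (m : ℕ) (W : Ω₀ → C(I, ℝ)) (Pr₀ : Measure Ω₀) (x z : ℝ) : ℝ :=
  max (Pr₀.real {a | x < |fFun m (W a)| ∧ hFun m (W a) ≤ z})
    (Pr₀.real {a | |fFun m (W a)| ≤ x ∧ hFun m (W a) ≤ z})

/-- An upper bound for the error in the rejection probability at Lévy–Prokhorov distance `ε` from
the law of `c W`. -/
noncomputable def rejectionBound (m : ℕ) (W : Ω₀ → C(I, ℝ)) (Pr₀ : Measure Ω₀) (x z c ε : ℝ) : ℝ :=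
  2 * (∫ y in (x - (1 + 2 * x) / (c * z) * ε)..(x + (1 + 2 * x) / (c * z) * ε),
    gaussianRatioDensity (fun a => hFun m (W a)) Pr₀ y) +
    smallDenominatorProb m W Pr₀ x z + (1 + 2 / (c * z)) * ε

/-- The two events together cover `h_m(W) ≤ z`, which contains the small ball `‖W‖ < z/2`. -/
theorem IsBrownianMotion.smallDenominatorProb_pos (hW : IsBrownianMotion W Pr₀) (hm : 1 ≤ m)
    {x z : ℝ} (hz : 0 < z) : 0 < smallDenominatorProb m W Pr₀ x z := by
  have := hW.isGaussianProcess.isProbabilityMeasure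
  by_contra! h
  rw [smallDenominatorProb, max_le_iff] at h
  have h1 := (measureReal_nonneg.antisymm' h.1)
  have h2 := (measureReal_nonneg.antisymm' h.2)
  rw [measureReal_eq_zero_iff] at h1 h2
  refine (hW.measure_norm_lt_pos (half_pos hz)).ne' (measure_mono_null ?_ (measure_union_null h1 h2))
  intro a (ha : ‖W a‖ < z / 2)
  have hz' : hFun m (W a) ≤ z := (hFun_le_norm hm _).trans (by linarith)
  exact (lt_or_ge x |fFun m (W a)|).imp (⟨·, hz'⟩) (⟨·, hz'⟩)

theorem IsBrownianMotion.continuous_ratioDensity (hW : IsBrownianMotion W Pr₀) (hm : 1 ≤ m) :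
    Continuous (gaussianRatioDensity (fun a => hFun m (W a)) Pr₀) :=
  continuous_gaussianRatioDensity (hW.integrable_hFun hm)

theorem IsBrownianMotion.continuous_rejectionBound (hW : IsBrownianMotion W Pr₀) (hm : 1 ≤ m)
    (x z c : ℝ) : Continuous (rejectionBound m W Pr₀ x z c) := by
  have hr := hW.continuous_ratioDensity hm
  have hint : ∀ a b, IntervalIntegrable (gaussianRatioDensity (fun a => hFun m (W a)) Pr₀)
      volume a b := fun a b => hr.intervalIntegrable a b
  have hF := intervalIntegral.continuous_primitive hint 0
  -- Both endpoints depend on `ε`, so the integral is split into values of one continuous primitive.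
  have he : rejectionBound m W Pr₀ x z c = fun ε =>
      2 * ((∫ y in (0 : ℝ)..(x + (1 + 2 * x) / (c * z) * ε),
        gaussianRatioDensity (fun a => hFun m (W a)) Pr₀ y) -
      ∫ y in (0 : ℝ)..(x - (1 + 2 * x) / (c * z) * ε),
        gaussianRatioDensity (fun a => hFun m (W a)) Pr₀ y) +
      smallDenominatorProb m W Pr₀ x z + (1 + 2 / (c * z)) * ε := by
    funext ε
    rw [intervalIntegral.integral_interval_sub_left (hint _ _) (hint _ _), rejectionBound]
  rw [he]
  have h1 := hF.comp (f := fun ε : ℝ => x + (1 + 2 * x) / (c * z) * ε) (by fun_prop)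
  have h2 := hF.comp (f := fun ε : ℝ => x - (1 + 2 * x) / (c * z) * ε) (by fun_prop)
  exact (((h1.sub h2).const_mul 2).add continuous_const).add (by fun_prop)

theorem rejectionBound_zero (x z c : ℝ) :
    rejectionBound m W Pr₀ x z c 0 = smallDenominatorProb m W Pr₀ x z := by
  simp [rejectionBound]

theorem IsBrownianMotion.measureReal_fFun_mem_Icc (hW : IsBrownianMotion W Pr₀) (hm : 1 ≤ m)
    {a b : ℝ} (hab : a ≤ b) :
    Pr₀.real {ω | fFun m (W ω) ∈ Set.Icc a b} =
      ∫ y in a..b, gaussianRatioDensity (fun a => hFun m (W a)) Pr₀ y := by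
  have hr := hW.continuous_ratioDensity hm
  have hf : Measurable fun ω => fFun m (W ω) := (measurable_fFun hm).comp hW.measurable
  have h : Pr₀ {ω | fFun m (W ω) ∈ Set.Icc a b} =
      Pr₀.map (fun ω => fFun m (W ω)) (Set.Icc a b) :=
    (Measure.map_apply hf measurableSet_Icc).symm
  rw [measureReal_def, h, hW.map_fFun hm, withDensity_apply _ measurableSet_Icc,
    intervalIntegral.integral_of_le hab, ← integral_Icc_eq_integral_Ioc,
    integral_eq_lintegral_of_nonneg_ae
      (.of_forall fun y => gaussianRatioDensity_nonneg (hW.hFun_pos hm) y)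
      hr.aestronglyMeasurable]

/-- The density is even, so the bands around `x` and `-x` contribute equally. -/
theorem IsBrownianMotion.measureReal_abs_fFun_mem_Icc_le (hW : IsBrownianMotion W Pr₀)
    (hm : 1 ≤ m) {a b : ℝ} (hab : a ≤ b) :
    Pr₀.real {ω | |fFun m (W ω)| ∈ Set.Icc a b} ≤
      2 * ∫ y in a..b, gaussianRatioDensity (fun a => hFun m (W a)) Pr₀ y := by
  have := hW.isGaussianProcess.isProbabilityMeasure
  have hneg : ∫ y in (-b)..(-a), gaussianRatioDensity (fun a => hFun m (W a)) Pr₀ y =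
      ∫ y in a..b, gaussianRatioDensity (fun a => hFun m (W a)) Pr₀ y := by
    rw [← intervalIntegral.integral_comp_neg]
    simp_rw [gaussianRatioDensity_neg]
  calc Pr₀.real {ω | |fFun m (W ω)| ∈ Set.Icc a b}
      ≤ Pr₀.real ({ω | fFun m (W ω) ∈ Set.Icc a b} ∪ {ω | fFun m (W ω) ∈ Set.Icc (-b) (-a)}) := by
        refine measureReal_mono fun ω hω => ?_
        obtain ⟨h1, h2⟩ := hω
        rcases abs_cases (fFun m (W ω)) with ⟨h, _⟩ | ⟨h, _⟩ <;> rw [h] at h1 h2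
        · exact Or.inl ⟨h1, h2⟩
        · exact Or.inr ⟨by linarith, by linarith⟩
    _ ≤ Pr₀.real {ω | fFun m (W ω) ∈ Set.Icc a b} +
        Pr₀.real {ω | fFun m (W ω) ∈ Set.Icc (-b) (-a)} := measureReal_union_le _ _
    _ = _ := by
        rw [hW.measureReal_fFun_mem_Icc hm hab,
          hW.measureReal_fFun_mem_Icc hm (neg_le_neg hab), hneg]
        ring

/-- A path `cW` in the `δ`-thickening of the rejection set, or of its complement, has three
possibilities: `W` is on the same side of `x`, `|f_m(W)|` is in the band, or `h_m(W) ≤ z`. The last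
term of the bound is the additive Prokhorov cost `δ` plus `2δ/(cz)`, which covers large `δ`. -/
theorem IsBrownianMotion.abs_sub_le_rejectionBound_of_lt (hW : IsBrownianMotion W Pr₀)
    (hm : 1 ≤ m) [IsProbabilityMeasure Pr] (hX : Measurable X) {x z c δ : ℝ} (hx : 0 < x)
    (hz : 0 < z) (hc : 0 < c)
    (hδ : levyProkhorovDist (Pr.map X) (Pr₀.map fun a => c • W a) < δ) :
    |Pr.real {ω | x < |fFun m (X ω)|} - Pr₀.real {a | x < |fFun m (W a)|}| ≤
      rejectionBound m W Pr₀ x z c δ := by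
  have := hW.isGaussianProcess.isProbabilityMeasure
  have hδ0 : 0 < δ := ENNReal.toReal_nonneg.trans_lt hδ
  have hcz : 0 < c * z := mul_pos hc hz
  have hcW : Measurable fun a => c • W a := (measurable_const_smul c).comp hW.measurable
  have hfm : Measurable fun φ : C(I, ℝ) => |fFun m φ| :=
    continuous_abs.measurable.comp (measurable_fFun hm)
  set k := (1 + 2 * x) / (c * z)
  have hk0 : 0 < k := by positivity
  have hab : x - k * δ ≤ x + k * δ := by nlinarith [mul_pos hk0 hδ0]
  set A : Set C(I, ℝ) := {φ | x < |fFun m φ|}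
  have hA : MeasurableSet A := hfm measurableSet_Ioi
  set band := Pr₀.real {a | |fFun m (W a)| ∈ Set.Icc (x - k * δ) (x + k * δ)}
  have hband_le := hW.measureReal_abs_fFun_mem_Icc_le hm hab
  have hs1 : Pr₀.real {a | x < |fFun m (W a)| ∧ hFun m (W a) ≤ z} ≤
      smallDenominatorProb m W Pr₀ x z := le_max_left _ _
  have hs2 : Pr₀.real {a | |fFun m (W a)| ≤ x ∧ hFun m (W a) ≤ z} ≤
      smallDenominatorProb m W Pr₀ x z := le_max_right _ _
  have hs0 := hW.smallDenominatorProb_pos hm (x := x) hz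
  have hband0 : 0 ≤ band := measureReal_nonneg
  have hbound : band + smallDenominatorProb m W Pr₀ x z + (1 + 2 / (c * z)) * δ ≤
      rejectionBound m W Pr₀ x z c δ := by
    rw [rejectionBound]
    linarith
  refine le_trans ?_ hbound
  have hPX : Pr.real {ω | x < |fFun m (X ω)|} = (Pr.map X).real A :=
    (map_measureReal_apply hX hA).symm
  have hlt : 2 / (c * z) * δ = 2 * δ / (c * z) := by ring
  -- For `2δ > cz` the perturbation estimate from above is unavailable, but then `2δ/(cz) ≥ 1`
  -- already dominates a difference of probabilities.
  rcases lt_or_ge (c * z) (2 * δ) with hlarge | hsmall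
  · have h1 : 1 ≤ 2 / (c * z) * δ := by
      rw [hlt, one_le_div hcz]
      exact hlarge.le
    have h2 : |Pr.real {ω | x < |fFun m (X ω)|} - Pr₀.real {a | x < |fFun m (W a)|}| ≤ 1 :=
      abs_sub_le_of_nonneg_of_le measureReal_nonneg measureReal_le_one measureReal_nonneg
        measureReal_le_one
    nlinarith
  have hextra : 0 ≤ 2 / (c * z) * δ := by positivity
  have hh : ∀ a, z < hFun m (W a) → c * z < hFun m (c • W a) := fun a ha => by
    rw [hFun_smul hm hc.le]
    gcongr
  have hPm : IsProbabilityMeasure (Pr.map X) := Measure.isProbabilityMeasure_map hX.aemeasurable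
  have hWm : IsProbabilityMeasure (Pr₀.map fun a => c • W a) :=
    Measure.isProbabilityMeasure_map hcW.aemeasurable
  have hup : (Pr.map X).real A ≤ Pr₀.real {a | x < |fFun m (W a)|} + band +
      smallDenominatorProb m W Pr₀ x z + δ := by
    refine (measureReal_le_of_levyProkhorovDist_lt hδ hA).trans ?_
    rw [map_measureReal_apply hcW Metric.isOpen_thickening.measurableSet]
    gcongr
    refine le_trans (measureReal_mono (μ := Pr₀) (s₂ := ({a | x < |fFun m (W a)|} ∪
      {a | |fFun m (W a)| ∈ Set.Icc (x - k * δ) (x + k * δ)}) ∪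
      {a | |fFun m (W a)| ≤ x ∧ hFun m (W a) ≤ z}) ?_) ?_
    · intro a ha
      obtain ⟨φ, hφ, hd⟩ := Metric.mem_thickening_iff.1 ha
      rcases lt_or_ge x |fFun m (W a)| with h | h
      · exact Or.inl (Or.inl h)
      rcases lt_or_ge z (hFun m (W a)) with h' | h'
      · refine Or.inl (Or.inr ⟨?_, h.trans (by nlinarith [mul_pos hk0 hδ0])⟩)
        have := le_abs_fFun_of_dist_lt hm hx hcz hd hφ (hh a h')
        rwa [fFun_smul hm hc] at this
      · exact Or.inr ⟨h, h'⟩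
    · linarith [measureReal_union_le (μ := Pr₀) ({a | x < |fFun m (W a)|} ∪
        {a | |fFun m (W a)| ∈ Set.Icc (x - k * δ) (x + k * δ)})
        {a | |fFun m (W a)| ≤ x ∧ hFun m (W a) ≤ z},
        measureReal_union_le (μ := Pr₀) {a | x < |fFun m (W a)|}
        {a | |fFun m (W a)| ∈ Set.Icc (x - k * δ) (x + k * δ)}]
  -- The Prokhorov inequality is one-sided, so the lower bound on the rejection probability comes
  -- from applying it to the complement.
  have hdown : (Pr.map X).real Aᶜ ≤ Pr₀.real {a | x < |fFun m (W a)|}ᶜ + band +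
      smallDenominatorProb m W Pr₀ x z + δ := by
    refine (measureReal_le_of_levyProkhorovDist_lt hδ hA.compl).trans ?_
    rw [map_measureReal_apply hcW Metric.isOpen_thickening.measurableSet]
    gcongr
    refine le_trans (measureReal_mono (μ := Pr₀) (s₂ := ({a | x < |fFun m (W a)|}ᶜ ∪
      {a | |fFun m (W a)| ∈ Set.Icc (x - k * δ) (x + k * δ)}) ∪
      {a | x < |fFun m (W a)| ∧ hFun m (W a) ≤ z}) ?_) ?_
    · intro a ha
      obtain ⟨φ, hφ, hd⟩ := Metric.mem_thickening_iff.1 ha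
      rcases le_or_gt |fFun m (W a)| x with h | h
      · exact Or.inl (Or.inl (not_lt.2 h))
      rcases lt_or_ge z (hFun m (W a)) with h' | h'
      · refine Or.inl (Or.inr ⟨le_trans (by nlinarith [mul_pos hk0 hδ0]) h.le, ?_⟩)
        have := abs_fFun_le_of_dist_lt hm hx hcz hd hsmall (not_lt.1 hφ) (hh a h')
        rwa [fFun_smul hm hc] at this
      · exact Or.inr ⟨h, h'⟩
    · linarith [measureReal_union_le (μ := Pr₀) ({a | x < |fFun m (W a)|}ᶜ ∪
        {a | |fFun m (W a)| ∈ Set.Icc (x - k * δ) (x + k * δ)})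
        {a | x < |fFun m (W a)| ∧ hFun m (W a) ≤ z},
        measureReal_union_le (μ := Pr₀) {a | x < |fFun m (W a)|}ᶜ
        {a | |fFun m (W a)| ∈ Set.Icc (x - k * δ) (x + k * δ)}]
  have hAW : MeasurableSet {a | x < |fFun m (W a)|} := (hfm.comp hW.measurable) measurableSet_Ioi
  rw [probReal_compl_eq_one_sub hA, probReal_compl_eq_one_sub hAW] at hdown
  rw [hPX, abs_sub_le_iff]
  constructor <;> linarith

/-- Thickening inequalities hold for `δ` strictly above the distance; letting `δ` decrease to it
uses continuity of the bound. -/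
theorem IsBrownianMotion.abs_sub_le_rejectionBound (hW : IsBrownianMotion W Pr₀)
    (hm : 1 ≤ m) [IsProbabilityMeasure Pr] (hX : Measurable X) {x z c : ℝ} (hx : 0 < x)
    (hz : 0 < z) (hc : 0 < c) :
    |Pr.real {ω | x < |fFun m (X ω)|} - Pr₀.real {a | x < |fFun m (W a)|}| ≤
      rejectionBound m W Pr₀ x z c
        (levyProkhorovDist (Pr.map X) (Pr₀.map fun a => c • W a)) := by
  refine ge_of_tendsto ((hW.continuous_rejectionBound hm x z c).continuousWithinAt
    (s := Set.Ioi (levyProkhorovDist (Pr.map X) (Pr₀.map fun a => c • W a)))) ?_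
  filter_upwards [self_mem_nhdsWithin] with δ hδ
  exact hW.abs_sub_le_rejectionBound_of_lt hm hX hx hz hc hδ

end Comparison

/-! ### The iterates -/

section Iterates

variable {d : ℕ} {Ξ Ω : Type*} [MeasurableSpace Ξ] [MeasurableSpace Ω] (M : SAProblem d Ξ)
  {ξ : ℕ → Ω → Ξ}

theorem SAProblem.measurable_iter (hξ : ∀ t, Measurable (ξ t)) (t : ℕ) :
    Measurable (M.iter ξ t) := by
  induction t with
  | zero => exact measurable_const
  | succ t ih =>
    exact ih.sub ((M.measurable_H.comp (ih.prodMk (hξ t))).const_smul (M.η t))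

theorem SAProblem.measurable_partialSum (hξ : ∀ t, Measurable (ξ t)) (T : ℕ) (r : ℝ) :
    Measurable fun ω => M.partialSum ξ T ω r := by
  unfold SAProblem.partialSum
  have := M.measurable_iter hξ
  fun_prop

theorem SAProblem.measurable_projPath_interp (hξ : ∀ t, Measurable (ξ t)) (θ : Vec d) (T : ℕ) :
    Measurable fun ω => projPath θ (M.interp ξ T ω) := by
  refine measurable_path fun r => ?_
  have := M.measurable_partialSum hξ T
  have h : Measurable fun ω => M.interp ξ T ω r := by
    change Measurable fun ω => M.partialSum ξ T ω 0 + ∑ n ∈ Finset.range T,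
      max 0 (min 1 ((T : ℝ) * r - n)) •
        (M.partialSum ξ T ω ((n + 1 : ℝ) / T) - M.partialSum ξ T ω ((n : ℝ) / T))
    fun_prop
  exact measurable_const.inner h

end Iterates


/-! ### Density and error bound -/

theorem mainTheorem9
    {Ω₀ : Type*} [MeasurableSpace Ω₀] {Pr₀ : Measure Ω₀} [IsProbabilityMeasure Pr₀]
    {W : Ω₀ → C(I, ℝ)} (hW : IsBrownianMotion W Pr₀) (m : ℕ) (hm : 1 ≤ m) :
    -- the law of `f_m(W)` has a (unique) continuous density `r`
    ∃ r : ℝ → ℝ, Continuous r ∧ (∀ y, 0 ≤ r y) ∧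
      Pr₀.map (fun a => fFun m (W a)) = volume.withDensity (fun y => ENNReal.ofReal (r y)) ∧
      ∀ x z ω : ℝ, 0 < x → 0 < z → 0 < ω →
        -- the remainder `R(ε) = o(ε)` depends only on `m`, `x`, `z` and `ω`
        ∃ R : ℝ → ℝ, R =o[𝓝 0] (fun ε : ℝ => ε) ∧
          ∀ {d : ℕ} {Ξ : Type*} [TopologicalSpace Ξ] [PolishSpace Ξ] [MeasurableSpace Ξ]
            [BorelSpace Ξ] {Ω : Type*} [MeasurableSpace Ω] (Pr : Measure Ω)
            [IsProbabilityMeasure Pr] (M : SAProblem d Ξ) (ξ : ℕ → Ω → Ξ)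
            {Ω' : Type*} [MeasurableSpace Ω'] (Pr' : Measure Ω') [IsProbabilityMeasure Pr']
            (B : Ω' → C(I, Vec d)) (θ : Vec d),
            M.Assumptions ξ Pr → IsBrownianMotionVec B Pr' → M.scale θ = ω →
            ∀ T : ℕ, 1 ≤ T →
              M.rejectionError ξ Pr W Pr₀ θ T m x ≤
                2 * (r x * ((x + 1) / z) * (M.epsP ξ Pr B Pr' θ T / ω) +
                  max (Pr₀.real {a | x < |fFun m (W a)| ∧ hFun m (W a) ≤ z})
                    (Pr₀.real {a | |fFun m (W a)| ≤ x ∧ hFun m (W a) ≤ z})) +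
                R (M.epsP ξ Pr B Pr' θ T) := by
  refine ⟨gaussianRatioDensity (fun a => hFun m (W a)) Pr₀, hW.continuous_ratioDensity hm,
    gaussianRatioDensity_nonneg (hW.hFun_pos hm), hW.map_fFun hm, ?_⟩
  intro x z ω hx hz hω
  -- `R` is the part of the comparison bound that exceeds the main term; it vanishes near `0`
  -- because the probability of a small denominator is positive and enters the main term twice.
  set r := gaussianRatioDensity (fun a => hFun m (W a)) Pr₀
  let D : ℝ → ℝ := fun ε => rejectionBound m W Pr₀ x z ω ε -
    2 * (r x * ((x + 1) / z) * (ε / ω) + smallDenominatorProb m W Pr₀ x z)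
  have hD : Continuous D := (hW.continuous_rejectionBound hm x z ω).sub (by fun_prop)
  have hD0 : D 0 < 0 := by
    have := hW.smallDenominatorProb_pos hm (x := x) hz
    simp only [D, rejectionBound_zero]
    simp only [zero_div, mul_zero, zero_add]
    linarith
  refine ⟨fun ε => max 0 (D ε), ?_, ?_⟩
  · refine (isLittleO_zero (fun ε : ℝ => ε) (𝓝 0)).congr' ?_ .rfl
    filter_upwards [hD.continuousAt.eventually_lt continuousAt_const hD0] with ε hε
    exact (max_eq_left hε.le).symm
  · intro d Ξ _ _ _ _ Ω _ Pr _ M ξ Ω' _ Pr' _ B θ hM hB hθ T _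
    have hX := M.measurable_projPath_interp hM.ergodic.1.1 θ T
    have hlaw := hB.map_projPath_matPath hW M.scaleMatrix θ
    have heps : M.epsP ξ Pr B Pr' θ T =
        levyProkhorovDist (Pr.map fun a => projPath θ (M.interp ξ T a))
          (Pr₀.map fun a => ω • W a) := by
      rw [SAProblem.epsP, hlaw, ← hθ]
      rfl
    have key := hW.abs_sub_le_rejectionBound hm (Pr := Pr) hX hx hz hω
    rw [← heps] at key
    -- `R ≥ D` everywhere, so the inequality holds for every `T` and not only when `ε_P` is small.
    have hle : D (M.epsP ξ Pr B Pr' θ T) ≤ max 0 (D (M.epsP ξ Pr B Pr' θ T)) := le_max_right _ _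
    refine key.trans ?_
    change _ ≤ 2 * (r x * ((x + 1) / z) * (M.epsP ξ Pr B Pr' θ T / ω) +
      smallDenominatorProb m W Pr₀ x z) + max 0 (D (M.epsP ξ Pr B Pr' θ T))
    simp only [D] at hle ⊢
    linarith
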